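/- Let $X=\mathbb{R}^n/\mathbb{Z}^n$ with quotient map $\pi$, let $dx$ be the measure on $X$ induced by Lebesgue measure, and let $d(\pi u,\pi v)=\inf_{m\in\mathbb{Z}^n}|u-v-m|$. Let $\mathcal{M}_1(X)$ be the space of Borel probability measures on $X$ with the topology of weak convergence. For $\mu\in\mathcal{M}_1(X)$ put $$W^2(\mu,dx)=\inf_{\gamma}\int_{X\times X}\frac{d(x,y)^2}{2}\,d\gamma(x,y),$$ where $\gamma$ runs over the measures on $X\times X$ with first marginal $\mu$ and second marginal $dx$. Let $\mu_0\in\mathcal{M}_1(X)$ be absolutely continuous with positive density with respect to $dx$. For each positive integer $k$ put $N=k^n$, let $p_1,\dots,p_N$ be the points of $\frac1k\mathbb{Z}^n/\mathbb{Z}^n\subset X$, and let $$\Psi^{(N)}_{p}(x)=\sum_{m\in\mathbb{Z}^n+p}e^{-k|x-m|^2/2}.$$ For $\beta\in\mathbb{R}$ let $\mu^{(N)}_\beta$ be the probability measure on $X^N$ given by $$\mu^{(N)}_\beta=\frac{1}{Z_{\beta,N}}\left(\sum_{\sigma}\prod_{i=1}^N\Psi^{(N)}_{p_i}(x_{\sigma(i)})\right)^{\beta/k}d\mu_0^{\otimes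 N},$$ where $\sigma$ runs over the permutations of $\{1,\dots,N\}$ and $Z_{\beta,N}$ is the normalizing constant, and let $\Gamma^{(N)}_\beta$ be the law, a Borel probability measure on $\mathcal{M}_1(X)$, of the empirical measure $\frac1N\sum_{i=1}^N\delta_{x_i}$ when $(x_1,\dots,x_N)$ has law $\mu^{(N)}_\beta$. Then, for the choice $\beta=k$, the sequence $\{\Gamma^{(N)}_k\}_{k\ge1}$ satisfies a large deviation principle with rate $r_N=kN$ and rate function $G(\mu)=W^2(\mu,dx)$. That is, $r_N\to\infty$, $G$ is lower semicontinuous, and for every Borel set $E\subset\mathcal{M}_1(X)$ with interior $E^\circ$ and closure $\bar E$, $$-\inf_{E^\circ}G\;\le\;\liminf_{k\to\infty}\frac{1}{kN}\log\Gamma^{(N)}_k(E)\;\le\;\limsup_{k\to\infty}\frac{1}{kN}\log\Gamma^{(N)}_k(E)\;\le\;-\inf_{\bar E}G .$$ -/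

import Mathlib

open MeasureTheory Filter Topology
open scoped ENNReal NNReal BoundedContinuousFunction

noncomputable section

namespace TorusLDP

/-! ### The flat torus -/

/-- The torus `ℝⁿ / ℤⁿ`. Its `volume` is the measure `dx` induced from `ℝⁿ`, of total mass one. -/
abbrev Torus (n : ℕ) : Type := UnitAddTorus (Fin n)

/-- The quotient map `π : ℝⁿ → ℝⁿ / ℤⁿ`. -/
def proj {n : ℕ} (u : EuclideanSpace ℝ (Fin n)) : Torus n :=
  fun i => (u i : UnitAddCircle)

/-- The vector of `ℝⁿ` with the integer coordinates `m`. -/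
def intVec {n : ℕ} (m : Fin n → ℤ) : EuclideanSpace ℝ (Fin n) :=
  WithLp.toLp 2 (fun i => (m i : ℝ))

lemma proj_eq_proj_iff {n : ℕ} (u v : EuclideanSpace ℝ (Fin n)) :
    proj u = proj v ↔ ∃ m : Fin n → ℤ, u = v + intVec m := by
  constructor
  · intro h
    have h' : ∀ i, ∃ m : ℤ, u i = v i + m := by
      intro i
      have hi : ((u i : ℝ) : UnitAddCircle) = (v i : ℝ) := congrFun h i
      rw [← sub_eq_zero, ← AddCircle.coe_sub, AddCircle.coe_eq_zero_iff] at hi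
      obtain ⟨m, hm⟩ := hi
      refine ⟨m, ?_⟩
      simp only [zsmul_eq_mul, mul_one] at hm
      linarith
    choose m hm using h'
    refine ⟨m, ?_⟩
    ext i
    simpa [intVec] using hm i
  · rintro ⟨m, rfl⟩
    funext i
    simp [proj, intVec]

/-- The distance on the torus induced from the Euclidean distance on `ℝⁿ`: the infimum of the
distances between lifts. -/
def torusDist {n : ℕ} (x y : Torus n) : ℝ :=
  sInf {r : ℝ | ∃ u v : EuclideanSpace ℝ (Fin n), proj u = x ∧ proj v = y ∧ r = ‖u - v‖}

lemma torusDist_proj {n : ℕ} (u v : EuclideanSpace ℝ (Fin n)) :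
    torusDist (proj u) (proj v) = ⨅ m : Fin n → ℤ, ‖u - v - intVec m‖ := by
  unfold torusDist iInf
  congr 1
  ext r
  constructor
  · rintro ⟨u', v', hu, hv, rfl⟩
    obtain ⟨a, rfl⟩ := (proj_eq_proj_iff _ _).1 hu
    obtain ⟨b, rfl⟩ := (proj_eq_proj_iff _ _).1 hv
    refine ⟨b - a, ?_⟩
    show ‖_‖ = ‖_‖
    congr 1
    ext i
    simp [intVec]
    ring
  · rintro ⟨m, rfl⟩
    exact ⟨u, v + intVec m, rfl, (proj_eq_proj_iff _ _).2 ⟨m, rfl⟩, by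
      show ‖_‖ = ‖_‖
      congr 1
      abel⟩

/-! ### The squared Wasserstein distance to `dx` -/

/-- The cost function `c = d² / 2`. -/
def cost {n : ℕ} (x y : Torus n) : ℝ := torusDist x y ^ 2 / 2

/-- The transport plans between two measures. -/
def transportPlans {n : ℕ} (μ ν : Measure (Torus n)) : Set (Measure (Torus n × Torus n)) :=
  {γ | γ.map Prod.fst = μ ∧ γ.map Prod.snd = ν}

/-- The infimum of the total cost of a transport plan between `μ` and `ν`, for the cost function
`c = d² / 2`. -/
def wassersteinSq {n : ℕ} (μ ν : Measure (Torus n)) : ℝ≥0∞ :=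
  ⨅ γ ∈ transportPlans μ ν, ∫⁻ z, ENNReal.ofReal (cost z.1 z.2) ∂γ

/-! ### The point processes -/

/-- The wave function `Ψ_p(x) = ∑_{m ∈ ℤⁿ + p} exp (-k |x - m|² / 2)`. When `m` runs through the
preimage `ℤⁿ + p` of `p`, the difference `u - m` with a lift `u` of `x` runs through the preimage
of `x - p`, whatever the lift is (see `waveFunction_proj`). -/
def waveFunction {n : ℕ} (k : ℕ) (p x : Torus n) : ℝ :=
  ∑' w : {w : EuclideanSpace ℝ (Fin n) // proj w = x - p}, Real.exp (-(k * ‖w.1‖ ^ 2 / 2))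

lemma waveFunction_proj {n : ℕ} (k : ℕ) (q u : EuclideanSpace ℝ (Fin n)) :
    waveFunction k (proj q) (proj u) =
      ∑' m : Fin n → ℤ, Real.exp (-(k * ‖u - (q + intVec m)‖ ^ 2 / 2)) := by
  have hsub : proj u - proj q = proj (u - q) := by
    funext i
    simp [proj]
  let f : (Fin n → ℤ) → {w : EuclideanSpace ℝ (Fin n) // proj w = proj u - proj q} :=
    fun m => ⟨u - (q + intVec m), by
      rw [hsub, proj_eq_proj_iff]
      refine ⟨-m, ?_⟩
      ext i
      simp [intVec]
      ring⟩
  have hf : Function.Bijective f := by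
    constructor
    · intro a b hab
      have h := congrArg Subtype.val hab
      funext i
      have hi := congrArg (fun w : EuclideanSpace ℝ (Fin n) => w i) h
      simpa [f, intVec] using hi
    · rintro ⟨w, hw⟩
      rw [hsub, proj_eq_proj_iff] at hw
      obtain ⟨m, rfl⟩ := hw
      refine ⟨-m, Subtype.ext ?_⟩
      ext i
      simp [f, intVec]
      ring
  unfold waveFunction
  exact (Equiv.tsum_eq (Equiv.ofBijective f hf)
    (fun w => Real.exp (-(k * ‖w.1‖ ^ 2 / 2)))).symm

/-- An enumeration of the `N = kⁿ` points of `(1/k)ℤⁿ / ℤⁿ`. -/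
def latticePoint (n k : ℕ) (i : Fin (k ^ n)) : Torus n :=
  proj (WithLp.toLp 2 fun j => ((finFunctionFinEquiv.symm i j : ℕ) : ℝ) / (k : ℝ))

/-- The permanent of the matrix `(Ψ_{p_i}(x_j))`. -/
def wavePermanent {n : ℕ} (k : ℕ) (x : Fin (k ^ n) → Torus n) : ℝ :=
  (Matrix.of fun i j => waveFunction k (latticePoint n k i) (x j)).permanent

/-- The measure `perm(Ψ_{p_i}(x_j))^{β/k} dμ₀^{⊗N}`, before normalization. -/
def unnormalizedProcess {n : ℕ} (μ₀ : Measure (Torus n)) (k : ℕ) (β : ℝ) :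
    Measure (Fin (k ^ n) → Torus n) :=
  (Measure.pi fun _ => μ₀).withDensity
    fun x => ENNReal.ofReal (wavePermanent k x ^ (β / (k : ℝ)))

/-- The `β`-deformed permanental point process `μ_β^{(N)}`. -/
def pointProcess {n : ℕ} (μ₀ : Measure (Torus n)) (k : ℕ) (β : ℝ) :
    Measure (Fin (k ^ n) → Torus n) :=
  (unnormalizedProcess μ₀ k β Set.univ)⁻¹ • unnormalizedProcess μ₀ k β

/-- The map `δ^{(N)}` that sends `(x_1, …, x_N)` to `(1/N) ∑ δ_{x_i}`. -/
def empiricalMeasure {n N : ℕ} [NeZero N] (x : Fin N → Torus n) :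
    ProbabilityMeasure (Torus n) :=
  ⟨(N : ℝ≥0∞)⁻¹ • ∑ i, Measure.dirac (x i), ⟨by
    simp [ENNReal.inv_mul_cancel (Nat.cast_ne_zero.2 (NeZero.ne N)) (ENNReal.natCast_ne_top N)]⟩⟩

/-- The law `Γ_β^{(N)}` of the empirical measure, where `N = kⁿ`. -/
def empiricalLaw {n : ℕ} (μ₀ : Measure (Torus n)) (k : ℕ+) (β : ℝ) :
    Measure (ProbabilityMeasure (Torus n)) :=
  (pointProcess μ₀ (k : ℕ) β).map empiricalMeasure

/-! ### Large deviation principles -/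

/-- The measurable structure that Mathlib puts on the space of probability measures is the Borel
structure of the topology of weak convergence. -/
instance borelSpace_probabilityMeasure {X : Type*} [TopologicalSpace X] [CompactSpace X]
    [TopologicalSpace.MetrizableSpace X] [MeasurableSpace X] [BorelSpace X] :
    BorelSpace (ProbabilityMeasure X) := by
  let _ : MetricSpace X := TopologicalSpace.metrizableSpaceMetric X
  constructor
  apply le_antisymm
  · refine measurable_iff_comap_le.1 ?_
    let _ : MeasurableSpace (ProbabilityMeasure X) := borel _
    have : BorelSpace (ProbabilityMeasure X) := ⟨rfl⟩
    refine Measurable.measure_of_isPiSystem_of_isProbabilityMeasure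
      (μ := fun ν : ProbabilityMeasure X => (ν : Measure X))
      (BorelSpace.measurable_eq.trans borel_eq_generateFrom_isClosed) isPiSystem_isClosed ?_
    intro F hF
    exact measurable_of_tendsto_metrizable
      (fun m => (ProbabilityMeasure.continuous_lintegral_boundedContinuousFunction
        (IsClosed.apprSeq hF m)).measurable)
      (tendsto_pi_nhds.2 fun μ => HasOuterApproxClosed.tendsto_lintegral_apprSeq hF (μ : Measure X))
  · have key : (inferInstance : TopologicalSpace (ProbabilityMeasure X)) =
        .generateFrom {s | ∃ (f : X →ᵇ ℝ≥0) (U : Set ℝ≥0∞), IsOpen U ∧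
          s = (fun μ : ProbabilityMeasure X => ∫⁻ x, f x ∂(μ : Measure X)) ⁻¹' U} := by
      apply le_antisymm
      · refine le_generateFrom ?_
        rintro s ⟨f, U, hU, rfl⟩
        exact hU.preimage (ProbabilityMeasure.continuous_lintegral_boundedContinuousFunction f)
      · rw [← continuous_id_iff_le]
        refine (@ProbabilityMeasure.continuous_iff_forall_continuous_lintegral X _ _ _ _ (_) id).2 ?_
        intro f
        refine continuous_def.2 fun U hU => ?_
        exact TopologicalSpace.isOpen_generateFrom_of_mem ⟨f, U, hU, rfl⟩
    rw [borel_eq_generateFrom_of_subbasis key]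
    refine MeasurableSpace.generateFrom_le ?_
    rintro s ⟨f, U, hU, rfl⟩
    have hm : Measurable fun μ : ProbabilityMeasure X => ∫⁻ x, f x ∂(μ : Measure X) :=
      (Measure.measurable_lintegral f.continuous.measurable.coe_nnreal_ennreal).comp
        measurable_subtype_coe
    exact hm hU.measurableSet

/-- A sequence `Γ` of (Borel) probability measures, indexed by the positive integers, satisfies a
large deviation principle with rate function `G` and rate `r`. -/
structure SatisfiesLDP {χ : Type*} [TopologicalSpace χ] [MeasurableSpace χ] [BorelSpace χ]
    (Γ : ℕ+ → Measure χ) (G : χ → EReal) (r : ℕ+ → ℝ) : Prop where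
  isProbabilityMeasure : ∀ k, IsProbabilityMeasure (Γ k)
  lowerSemicontinuous : LowerSemicontinuous G
  tendsto_rate : Tendsto r atTop atTop
  lower_bound : ∀ E : Set χ, MeasurableSet E →
    -(⨅ μ ∈ interior E, G μ) ≤ liminf (fun k => ENNReal.log (Γ k E) / (r k : EReal)) atTop
  upper_bound : ∀ E : Set χ, MeasurableSet E →
    limsup (fun k => ENNReal.log (Γ k E) / (r k : EReal)) atTop ≤ -(⨅ μ ∈ closure E, G μ)

end TorusLDP

end

/-!
Since `β = k`, the density of the process is the permanent itself, a sum over permutations of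
products of one-particle factors, and both large deviation bounds come from direct estimates of it.

The wave function `Ψ_p(x)` equals `exp (-k c(x, p))` up to a factor between `1` and a constant that
depends on the dimension only (`waveFunction_bounds`). Hence each of the `N!` terms of the permanent
is `exp (-k ∑ c(x_j, p_{σ j}))` up to a factor `exp (O(N))`, which is negligible at speed `k N`. The
partition function is `N!` times a factor `exp (o(kN))`: it is at most `N! exp (O(N))`, and for the
bound from below it suffices to integrate over small balls around the lattice points, whose
`μ₀`-mass is uniformly positive because `μ₀` charges every nonempty open set and the torus is
compact (`exists_pos_le_measure_ball`).

Upper bound. Any matching of a configuration with the lattice gives a transport plan between the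
empirical measure and `dx`: the cell of volume `1/N` at a lattice point is matched with the
corresponding point of the configuration. So the mean cost of a matching is at least the optimal
cost up to `n/k` (`wassersteinSq_empiricalMeasure_le`), and on an event on which the rate function
is at least `g` the density is at most `N! exp (-kN (g - o(1)))` pointwise. As the reference measure
has mass one, no entropy term appears.

Lower bound. Let `U` be a neighbourhood of `μ`, and take a nearly optimal plan between `μ` and `dx`.
Sampling, independently for each lattice point, from the law of the first component of the plan
conditioned on the second one lying in the cell gives a random configuration. Its expected mean cost
is that of the plan up to `n/k`, and its averages of finitely many test functions have expectations
given by `μ` and variances `O(1/N)`. A first moment argument for the cost plus a multiple of the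
squared deviations yields one good configuration (`exists_configuration_le`,
`eventually_exists_configuration`). All configurations in a product of small balls around it have
their empirical measure in `U`, and the integral of the density over that product is large enough
(`le_unnormalizedProcess`).

Lower semicontinuity of the rate function follows from the compactness of the space of probability
measures on the product (`lowerSemicontinuous_iInf_plan`).
-/

namespace TorusLDP

open scoped Nat

/-! ### The distance and the cost in coordinates -/

lemma norm_coe_unitAddCircle_le (a : ℝ) : ‖(a : UnitAddCircle)‖ ≤ |a| := by
  rw [UnitAddCircle.norm_eq]
  simpa using round_le a 0

/-- Every point of the torus has a lift all of whose coordinates are as small as possible. -/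
lemma exists_minimal_lift {n : ℕ} (z : Torus n) :
    ∃ w : EuclideanSpace ℝ (Fin n), proj w = z ∧ ∀ i, |w i| = ‖z i‖ := by
  have h : ∀ i, ∃ a : ℝ, (a : UnitAddCircle) = z i ∧ |a| = ‖z i‖ := by
    intro i
    obtain ⟨b, hb⟩ := QuotientAddGroup.mk_surjective (z i)
    replace hb : (b : UnitAddCircle) = z i := hb
    refine ⟨b - round b, ?_, ?_⟩
    · rw [← hb, ← sub_eq_zero, ← AddCircle.coe_sub, AddCircle.coe_eq_zero_iff]
      exact ⟨-round b, by simp⟩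
    · rw [← hb, UnitAddCircle.norm_eq]
  choose a ha ha' using h
  exact ⟨WithLp.toLp 2 a, funext ha, ha'⟩

lemma exists_lift {n : ℕ} (z : Torus n) : ∃ w : EuclideanSpace ℝ (Fin n), proj w = z :=
  (exists_minimal_lift z).imp fun _ h => h.1

lemma proj_add {n : ℕ} (u v : EuclideanSpace ℝ (Fin n)) : proj (u + v) = proj u + proj v := by
  funext i
  simp [proj]

lemma torusDist_eq_sqrt {n : ℕ} (x y : Torus n) :
    torusDist x y = √(∑ i, ‖x i - y i‖ ^ 2) := by
  refine IsLeast.csInf_eq ⟨?_, ?_⟩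
  · obtain ⟨v, hv⟩ := exists_lift y
    obtain ⟨w, hw, hw'⟩ := exists_minimal_lift (x - y)
    refine ⟨v + w, v, ?_, hv, ?_⟩
    · rw [proj_add, hv, hw]
      abel
    · rw [add_sub_cancel_left, EuclideanSpace.norm_eq]
      simp only [Real.norm_eq_abs, hw', Pi.sub_apply]
  · rintro r ⟨u, v, rfl, rfl, rfl⟩
    rw [EuclideanSpace.norm_eq]
    gcongr with i
    exact norm_coe_unitAddCircle_le (u i - v i)

lemma cost_eq {n : ℕ} (x y : Torus n) : cost x y = (∑ i, ‖x i - y i‖ ^ 2) / 2 := by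
  rw [cost, torusDist_eq_sqrt, Real.sq_sqrt (Finset.sum_nonneg fun _ _ => sq_nonneg _)]

lemma cost_nonneg {n : ℕ} (x y : Torus n) : 0 ≤ cost x y :=
  div_nonneg (sq_nonneg _) zero_le_two

lemma continuous_cost {n : ℕ} : Continuous fun z : Torus n × Torus n => cost z.1 z.2 := by
  simp_rw [cost_eq]
  fun_prop

lemma norm_unitAddCircle_le_half (a : UnitAddCircle) : ‖a‖ ≤ 1 / 2 := by
  simpa using AddCircle.norm_le_half_period (1 : ℝ) one_ne_zero (x := a)

lemma cost_le {n : ℕ} (x y : Torus n) : cost x y ≤ n := by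
  rw [cost_eq]
  have h : ∑ i, ‖x i - y i‖ ^ 2 ≤ ∑ _i : Fin n, (1 : ℝ) := by
    gcongr with i
    have := norm_unitAddCircle_le_half (x i - y i)
    have h0 := norm_nonneg (x i - y i)
    nlinarith
  simp only [Finset.sum_const, Finset.card_univ, Fintype.card_fin, nsmul_eq_mul, mul_one] at h
  have : (0 : ℝ) ≤ n := by positivity
  linarith

/-- The cost is Lipschitz for the sup distance of the torus. -/
lemma cost_le_cost_add {n : ℕ} (x y x' y' : Torus n) :
    cost x y ≤ cost x' y' + n * (dist x x' + dist y y') := by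
  have h : ∑ i, ‖x i - y i‖ ^ 2 ≤ ∑ i, (‖x' i - y' i‖ ^ 2 + (dist x x' + dist y y')) := by
    gcongr with i
    have h1 := norm_unitAddCircle_le_half (x i - y i)
    have h2 := norm_unitAddCircle_le_half (x' i - y' i)
    have h3 := norm_nonneg (x i - y i)
    have h4 := norm_nonneg (x' i - y' i)
    have h5 := dist_le_pi_dist x x' i
    have h6 := dist_le_pi_dist y y' i
    have h7 : ‖x i - y i‖ ≤ ‖x' i - y' i‖ + (dist x x' + dist y y') := by
      rw [← dist_eq_norm, ← dist_eq_norm]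
      have h8 := dist_triangle4 (x i) (x' i) (y' i) (y i)
      rw [dist_comm (y' i)] at h8
      linarith
    have h9 : 0 ≤ dist x x' + dist y y' := by positivity
    nlinarith
  rw [cost_eq, cost_eq]
  rw [Finset.sum_add_distrib] at h
  simp only [Finset.sum_const, Finset.card_univ, Fintype.card_fin, nsmul_eq_mul] at h
  have : 0 ≤ n * (dist x x' + dist y y') := by positivity
  linarith

/-! ### Gaussian bounds on the wave functions -/

lemma sq_sub_abs_nonneg (m : ℤ) : (0 : ℝ) ≤ (m : ℝ) ^ 2 - |(m : ℝ)| := by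
  have h : |m| ≤ m ^ 2 := by
    rw [← sq_abs]
    have := abs_nonneg m
    nlinarith [Int.le_self_sq |m|]
  have : |(m : ℝ)| ≤ (m : ℝ) ^ 2 := by exact_mod_cast h
  linarith

lemma summable_exp_neg_sq_sub_abs :
    Summable fun m : ℤ => Real.exp (-(((m : ℝ) ^ 2 - |(m : ℝ)|) / 2)) := by
  have hnat : Summable fun m : ℕ => Real.exp 1 * Real.exp (-(m : ℝ)) :=
    Real.summable_exp_neg_nat.mul_left _
  have hle : ∀ m : ℕ, Real.exp (-(((m : ℝ) ^ 2 - |(m : ℝ)|) / 2)) ≤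
      Real.exp 1 * Real.exp (-(m : ℝ)) := by
    intro m
    rw [← Real.exp_add, Nat.abs_cast]
    gcongr
    have h : (0 : ℤ) ≤ ((m : ℤ) - 1) * ((m : ℤ) - 2) := by
      rcases le_or_gt (m : ℤ) 1 with h | h
      · exact mul_nonneg_of_nonpos_of_nonpos (by omega) (by omega)
      · exact mul_nonneg (by omega) (by omega)
    have h' : (0 : ℝ) ≤ ((m : ℝ) - 1) * ((m : ℝ) - 2) := by exact_mod_cast h
    linarith
  refine Summable.of_nat_of_neg ?_ ?_
  · simpa using Summable.of_nonneg_of_le (fun _ => (Real.exp_pos _).le) hle hnat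
  · simpa using Summable.of_nonneg_of_le (fun _ => (Real.exp_pos _).le) hle hnat

/-- For a minimal lift `w`, passing from `w` to another lift `w - m` costs a factor that is summable
over `m` and does not depend on `k`. -/
lemma exp_neg_norm_sub_intVec_le {n k : ℕ} (hk : 1 ≤ k) (w : EuclideanSpace ℝ (Fin n))
    (hw : ∀ i, |w i| ≤ 1 / 2) (m : Fin n → ℤ) :
    Real.exp (-(k * ‖w - intVec m‖ ^ 2 / 2)) ≤ Real.exp (-(k * ‖w‖ ^ 2 / 2)) *
      ∏ i, Real.exp (-(((m i : ℝ) ^ 2 - |(m i : ℝ)|) / 2)) := by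
  rw [← Real.exp_sum, ← Real.exp_add]
  gcongr
  rw [EuclideanSpace.norm_sq_eq, EuclideanSpace.norm_sq_eq, Finset.sum_neg_distrib,
    ← Finset.sum_div]
  simp only [Real.norm_eq_abs, sq_abs, PiLp.sub_apply, intVec]
  have h : ∑ i, (w i) ^ 2 + ∑ i, ((m i : ℝ) ^ 2 - |(m i : ℝ)|) ≤ ∑ i, (w i - m i) ^ 2 := by
    rw [← Finset.sum_add_distrib]
    gcongr with i
    have h1 : w i * m i ≤ |w i| * |(m i : ℝ)| := by
      rw [← abs_mul]
      exact le_abs_self _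
    have h2 := hw i
    have h3 := abs_nonneg (m i : ℝ)
    nlinarith
  have h0 : 0 ≤ ∑ i, ((m i : ℝ) ^ 2 - |(m i : ℝ)|) :=
    Finset.sum_nonneg fun i _ => sq_sub_abs_nonneg _
  have hk' : (1 : ℝ) ≤ k := by exact_mod_cast hk
  nlinarith

/-- Multidimensional sums of products of a nonnegative summable function are bounded by the power
of its one-dimensional sum. -/
lemma sum_prod_le_tsum_pow {n : ℕ} {g : ℤ → ℝ} (hg : Summable g) (h0 : ∀ m, 0 ≤ g m)
    (s : Finset (Fin n → ℤ)) : ∑ m ∈ s, ∏ i, g (m i) ≤ (∑' m, g m) ^ n := by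
  classical
  calc ∑ m ∈ s, ∏ i, g (m i)
      ≤ ∑ m ∈ Fintype.piFinset fun i => s.image fun m => m i, ∏ i, g (m i) := by
        refine Finset.sum_le_sum_of_subset_of_nonneg ?_ fun _ _ _ =>
          Finset.prod_nonneg fun _ _ => h0 _
        intro m hm
        exact Fintype.mem_piFinset.2 fun i => Finset.mem_image_of_mem _ hm
    _ = ∏ i, ∑ a ∈ s.image fun m => m i, g a := (Finset.prod_univ_sum _ _).symm
    _ ≤ ∏ _i : Fin n, ∑' m, g m := by
        refine Finset.prod_le_prod (fun _ _ => Finset.sum_nonneg fun _ _ => h0 _) fun i _ => ?_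
        exact hg.sum_le_tsum _ fun _ _ => h0 _
    _ = (∑' m, g m) ^ n := by simp

lemma summable_prod_of_summable {n : ℕ} {g : ℤ → ℝ} (hg : Summable g) (h0 : ∀ m, 0 ≤ g m) :
    Summable fun m : Fin n → ℤ => ∏ i, g (m i) :=
  summable_of_sum_le (fun _ => Finset.prod_nonneg fun _ _ => h0 _)
    (sum_prod_le_tsum_pow hg h0)

/-- The Gaussian constant `(∑_{m ∈ ℤ} exp (-(m² - |m|) / 2))ⁿ`, which compares a wave function with
the contribution of its nearest lattice point. -/
noncomputable def gaussConst (n : ℕ) : ℝ :=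
  (∑' m : ℤ, Real.exp (-(((m : ℝ) ^ 2 - |(m : ℝ)|) / 2))) ^ n

lemma exists_lifts_sub_minimal {n : ℕ} (p x : Torus n) :
    ∃ q w : EuclideanSpace ℝ (Fin n), proj q = p ∧ proj (q + w) = x ∧ (∀ i, |w i| ≤ 1 / 2) ∧
      cost x p = ‖w‖ ^ 2 / 2 := by
  obtain ⟨q, hq⟩ := exists_lift p
  obtain ⟨w, hw, hw'⟩ := exists_minimal_lift (x - p)
  refine ⟨q, w, hq, ?_, fun i => ?_, ?_⟩
  · rw [proj_add, hq, hw]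
    abel
  · rw [hw']
    exact norm_unitAddCircle_le_half _
  · rw [cost_eq, EuclideanSpace.norm_sq_eq]
    simp only [Real.norm_eq_abs, hw', Pi.sub_apply]

/-- The wave function is comparable with its largest term, uniformly in `k`, `p` and `x`. -/
lemma waveFunction_bounds {n k : ℕ} (hk : 1 ≤ k) (p x : Torus n) :
    Real.exp (-(k * cost x p)) ≤ waveFunction k p x ∧
      waveFunction k p x ≤ gaussConst n * Real.exp (-(k * cost x p)) := by
  obtain ⟨q, w, rfl, rfl, hw, hc⟩ := exists_lifts_sub_minimal p x
  rw [waveFunction_proj, hc]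
  have hterm : ∀ m, q + w - (q + intVec m) = w - intVec m := fun m => by abel
  simp only [hterm]
  have hle := exp_neg_norm_sub_intVec_le hk w hw
  have hprod := summable_prod_of_summable (n := n) summable_exp_neg_sq_sub_abs
    fun _ => (Real.exp_pos _).le
  have hs : Summable fun m : Fin n → ℤ => Real.exp (-(k * ‖w - intVec m‖ ^ 2 / 2)) :=
    Summable.of_nonneg_of_le (fun _ => (Real.exp_pos _).le) hle (hprod.mul_left _)
  rw [← mul_div_assoc]
  constructor
  · have h := hs.le_tsum 0 fun _ _ => (Real.exp_pos _).le
    have h0 : intVec (0 : Fin n → ℤ) = 0 := by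
      ext i
      simp [intVec]
    rwa [h0, sub_zero] at h
  · refine (hs.tsum_le_tsum hle (hprod.mul_left _)).trans ?_
    rw [tsum_mul_left, mul_comm]
    gcongr
    exact hprod.tsum_le_of_sum_le
      (sum_prod_le_tsum_pow summable_exp_neg_sq_sub_abs fun _ => (Real.exp_pos _).le)

lemma waveFunction_pos {n k : ℕ} (hk : 1 ≤ k) (p x : Torus n) : 0 < waveFunction k p x :=
  (Real.exp_pos _).trans_le (waveFunction_bounds hk p x).1

lemma one_le_gaussConst (n : ℕ) : 1 ≤ gaussConst n := by
  have h := waveFunction_bounds le_rfl (0 : Torus n) 0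
  exact (le_mul_iff_one_le_left (Real.exp_pos _)).1 (h.1.trans h.2)

lemma measurable_waveFunction {n : ℕ} (k : ℕ) (p : Torus n) :
    Measurable fun x => waveFunction k p x := by
  obtain ⟨q, rfl⟩ := exists_lift p
  -- A measurable lift turns the sum over a varying fibre into a sum over `ℤⁿ`.
  let s : Torus n → EuclideanSpace ℝ (Fin n) := fun x =>
    WithLp.toLp 2 fun i => ((AddCircle.measurableEquivIco (1 : ℝ) 0 (x i) : ℝ))
  have hs : Measurable s := by
    refine (WithLp.measurable_toLp 2 _).comp ?_
    refine measurable_pi_lambda _ fun i => ?_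
    exact measurable_subtype_coe.comp
      ((AddCircle.measurableEquivIco (1 : ℝ) 0).measurable.comp (measurable_pi_apply i))
  have hproj : ∀ x, proj (s x) = x := fun x => by
    funext i
    exact (AddCircle.measurableEquivIco (1 : ℝ) 0).symm_apply_apply (x i)
  have h : (fun x => waveFunction k (proj q) x) = fun x => (∑' m : Fin n → ℤ,
      ENNReal.ofReal (Real.exp (-(k * ‖s x - (q + intVec m)‖ ^ 2 / 2)))).toReal := by
    funext x
    rw [ENNReal.tsum_toReal_eq fun _ => ENNReal.ofReal_ne_top]
    simp only [ENNReal.toReal_ofReal (Real.exp_pos _).le, ← waveFunction_proj, hproj]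
  rw [h]
  refine (Measurable.tsum fun m => ?_).ennreal_toReal
  fun_prop

/-! ### Lower semicontinuity of the optimal cost -/

/-- Plans with second marginal `ν` form a closed subset of the compact space of probability measures
on `X × X`, on which the total cost is continuous; sublevel sets of the optimal cost are
intersections of images of compact sets. -/
lemma lowerSemicontinuous_iInf_plan {X : Type*} [MetricSpace X] [CompactSpace X]
    [SecondCountableTopology X] [MeasurableSpace X] [BorelSpace X] (c : X × X → ℝ≥0)
    (hc : Continuous c) (ν : Measure X) [IsProbabilityMeasure ν] :
    LowerSemicontinuous fun μ : ProbabilityMeasure X =>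
      ⨅ γ ∈ {γ : Measure (X × X) | γ.map Prod.fst = μ ∧ γ.map Prod.snd = ν}, ∫⁻ z, c z ∂γ := by
  rw [lowerSemicontinuous_iff_isClosed_preimage]
  intro y
  let S : ℝ≥0∞ → Set (ProbabilityMeasure (X × X)) := fun s =>
    {γ | γ.map measurable_snd.aemeasurable = (⟨ν, inferInstance⟩ : ProbabilityMeasure X) ∧
      ∫⁻ z, c z ∂(γ : Measure (X × X)) ≤ s}
  let F : ProbabilityMeasure (X × X) → ProbabilityMeasure X := fun γ =>
    γ.map measurable_fst.aemeasurable
  have hF : Continuous F := ProbabilityMeasure.continuous_map continuous_fst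
  have hS : ∀ s, IsClosed (F '' S s) := by
    intro s
    have h1 : IsClosed {γ : ProbabilityMeasure (X × X) |
        γ.map measurable_snd.aemeasurable = (⟨ν, inferInstance⟩ : ProbabilityMeasure X)} :=
      isClosed_eq (ProbabilityMeasure.continuous_map continuous_snd) continuous_const
    have h2 : IsClosed {γ : ProbabilityMeasure (X × X) |
        ∫⁻ z, c z ∂(γ : Measure (X × X)) ≤ s} :=
      isClosed_le (ProbabilityMeasure.continuous_lintegral_boundedContinuousFunction
        (BoundedContinuousFunction.mkOfCompact ⟨c, hc⟩)) continuous_const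
    exact ((h1.inter h2).isCompact.image hF).isClosed
  have key : (fun μ : ProbabilityMeasure X =>
      ⨅ γ ∈ {γ : Measure (X × X) | γ.map Prod.fst = μ ∧ γ.map Prod.snd = ν},
        ∫⁻ z, c z ∂γ) ⁻¹' Set.Iic y = ⋂ s > y, F '' S s := by
    ext μ
    simp only [Set.mem_preimage, Set.mem_Iic, Set.mem_iInter]
    constructor
    · intro h s hs
      obtain ⟨γ, hγ⟩ := iInf_lt_iff.1 (h.trans_lt hs)
      obtain ⟨⟨hγ1, hγ2⟩, hγ3⟩ := iInf_lt_iff.1 hγ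
      have hprob : IsProbabilityMeasure γ := by
        constructor
        have := congrArg (fun m => m Set.univ) hγ1
        simpa [Measure.map_apply measurable_fst MeasurableSet.univ] using this
      exact ⟨⟨γ, hprob⟩, ⟨Subtype.ext hγ2, hγ3.le⟩, Subtype.ext hγ1⟩
    · intro h
      refine le_of_forall_gt_imp_ge_of_dense fun s hs => ?_
      obtain ⟨γ, ⟨hγ2, hγ3⟩, hγ1⟩ := h s hs
      exact (iInf₂_le (γ : Measure (X × X))
        ⟨congrArg Subtype.val hγ1, congrArg Subtype.val hγ2⟩).trans hγ3
  rw [key]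
  exact isClosed_biInter fun s _ => hS s

instance isProbabilityMeasure_volume_unitAddCircle :
    IsProbabilityMeasure (volume : Measure UnitAddCircle) := ⟨by simp⟩

lemma lowerSemicontinuous_wassersteinSq (n : ℕ) :
    LowerSemicontinuous fun μ : ProbabilityMeasure (Torus n) =>
      wassersteinSq (μ : Measure (Torus n)) volume :=
  lowerSemicontinuous_iInf_plan (fun z : Torus n × Torus n => (cost z.1 z.2).toNNReal)
    (continuous_real_toNNReal.comp continuous_cost) volume

lemma wassersteinSq_ne_top {n : ℕ} (μ : Measure (Torus n)) [IsProbabilityMeasure μ] :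
    wassersteinSq μ volume ≠ ∞ := by
  have h : wassersteinSq μ volume ≤ ∫⁻ z, ENNReal.ofReal (cost z.1 z.2) ∂(μ.prod volume) :=
    iInf₂_le _ ⟨by simp, by simp⟩
  refine ne_of_lt ((h.trans (lintegral_mono fun z =>
    ENNReal.ofReal_le_ofReal (cost_le _ _))).trans_lt ?_)
  simp

/-! ### The cells of the lattice -/

/-- The index `a` of the interval `(a/k, (a+1)/k]` of the circle which contains a point. The lift in
`(0, 1]` is used, so that the ceiling is positive and the subtraction does not truncate. -/
noncomputable def circleIndex (k : ℕ) [NeZero k] (z : UnitAddCircle) : Fin k :=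
  ⟨⌈(k : ℝ) * (AddCircle.measurableEquivIoc (1 : ℝ) 0 z : ℝ)⌉₊ - 1, by
    have hk : 0 < k := Nat.pos_of_ne_zero (NeZero.ne k)
    have h := (AddCircle.measurableEquivIoc (1 : ℝ) 0 z).2.2
    have : ⌈(k : ℝ) * (AddCircle.measurableEquivIoc (1 : ℝ) 0 z : ℝ)⌉₊ ≤ k := by
      rw [Nat.ceil_le]
      exact mul_le_of_le_one_right (by positivity) (h.trans_eq (zero_add _))
    omega⟩

lemma measurable_circleIndex (k : ℕ) [NeZero k] : Measurable (circleIndex k) := by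
  refine measurable_to_countable' fun a => ?_
  have h : Measurable fun z : UnitAddCircle =>
      ⌈(k : ℝ) * (AddCircle.measurableEquivIoc (1 : ℝ) 0 z : ℝ)⌉₊ - 1 := by
    have := (AddCircle.measurableEquivIoc (1 : ℝ) 0).measurable
    have h2 : Measurable fun z : UnitAddCircle =>
      ⌈(k : ℝ) * (AddCircle.measurableEquivIoc (1 : ℝ) 0 z : ℝ)⌉₊ :=
      Nat.measurable_ceil.comp (by fun_prop)
    exact (measurable_from_top (f := fun m : ℕ => m - 1)).comp h2
  have heq : circleIndex k ⁻¹' {a} = (fun z : UnitAddCircle =>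
      ⌈(k : ℝ) * (AddCircle.measurableEquivIoc (1 : ℝ) 0 z : ℝ)⌉₊ - 1) ⁻¹' {(a : ℕ)} := by
    ext z
    simp [circleIndex, Fin.ext_iff]
  rw [heq]
  exact h (measurableSet_singleton _)

lemma circleIndex_coe_eq_iff (k : ℕ) [NeZero k] {r : ℝ} (hr : r ∈ Set.Ioc (0 : ℝ) 1) (a : Fin k) :
    circleIndex k (r : UnitAddCircle) = a ↔ r ∈ Set.Ioc ((a : ℝ) / k) (((a : ℝ) + 1) / k) := by
  have hk : (0 : ℝ) < k := by exact_mod_cast Nat.pos_of_ne_zero (NeZero.ne k)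
  have h : (AddCircle.measurableEquivIoc (1 : ℝ) 0 (r : UnitAddCircle) : ℝ) = r :=
    (AddCircle.equivIoc_coe_of_mem (p := (1 : ℝ)) (a := 0) (by simpa using hr))
  have hpos : 0 < ⌈(k : ℝ) * r⌉₊ := Nat.ceil_pos.2 (mul_pos hk hr.1)
  rw [Fin.ext_iff]
  simp only [circleIndex, h]
  rw [show (⌈(k : ℝ) * r⌉₊ - 1 = (a : ℕ)) ↔ ⌈(k : ℝ) * r⌉₊ = (a : ℕ) + 1 by omega,
    Nat.ceil_eq_iff (by omega), Set.mem_Ioc, div_lt_iff₀ hk, le_div_iff₀ hk]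
  simp [mul_comm]

lemma volume_circleIndex_preimage (k : ℕ) [NeZero k] (a : Fin k) :
    volume (circleIndex k ⁻¹' {a}) = (k : ℝ≥0∞)⁻¹ := by
  have hk : (0 : ℝ) < k := by exact_mod_cast Nat.pos_of_ne_zero (NeZero.ne k)
  rw [AddCircle.add_projection_respects_measure 1 0
    (measurable_circleIndex k (measurableSet_singleton a))]
  have h : (QuotientAddGroup.mk ⁻¹' (circleIndex k ⁻¹' {a}) ∩ Set.Ioc 0 (0 + 1) : Set ℝ) =
      Set.Ioc ((a : ℝ) / k) (((a : ℝ) + 1) / k) := by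
    ext r
    rw [zero_add]
    constructor
    · rintro ⟨h1, h2⟩
      exact (circleIndex_coe_eq_iff k h2 a).1 h1
    · intro h
      have hr : r ∈ Set.Ioc (0 : ℝ) 1 := by
        refine ⟨lt_of_le_of_lt (by positivity) h.1, h.2.trans ?_⟩
        rw [div_le_one hk]
        exact_mod_cast a.2
      exact ⟨(circleIndex_coe_eq_iff k hr a).2 h, hr⟩
  rw [h, Real.volume_Ioc, add_div, add_sub_cancel_left, one_div, ENNReal.ofReal_inv_of_pos hk,
    ENNReal.ofReal_natCast]

lemma dist_circleIndex_le (k : ℕ) [NeZero k] (z : UnitAddCircle) :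
    dist z (((circleIndex k z : ℕ) : ℝ) / (k : ℝ) : ℝ) ≤ (k : ℝ)⁻¹ := by
  have hk : (0 : ℝ) < k := by exact_mod_cast Nat.pos_of_ne_zero (NeZero.ne k)
  obtain ⟨r, hr, rfl⟩ : ∃ r ∈ Set.Ioc (0 : ℝ) 1, (r : UnitAddCircle) = z := by
    have h := (AddCircle.equivIoc (1 : ℝ) 0 z).2
    exact ⟨_, ⟨h.1, h.2.trans_eq (zero_add _)⟩, AddCircle.coe_equivIoc⟩
  obtain ⟨h1, h2⟩ := (circleIndex_coe_eq_iff k hr _).1 rfl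
  rw [dist_eq_norm, ← AddCircle.coe_sub]
  refine (norm_coe_unitAddCircle_le _).trans ?_
  rw [add_div, one_div] at h2
  rw [abs_of_nonneg] <;> linarith

/-- The index of the half-open cube of side `1/k`, with a corner at a lattice point, which contains
a point of the torus. -/
noncomputable def cellIndex {n : ℕ} (k : ℕ) [NeZero k] (z : Torus n) : Fin (k ^ n) :=
  finFunctionFinEquiv fun j => circleIndex k (z j)

lemma cellIndex_preimage {n : ℕ} (k : ℕ) [NeZero k] (i : Fin (k ^ n)) :
    (cellIndex k ⁻¹' {i} : Set (Torus n)) =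
      Set.univ.pi fun j => circleIndex k ⁻¹' {finFunctionFinEquiv.symm i j} := by
  ext z
  simp only [Set.mem_preimage, Set.mem_singleton_iff, Set.mem_univ_pi, cellIndex]
  rw [← Equiv.eq_symm_apply, funext_iff]

lemma measurable_cellIndex {n : ℕ} (k : ℕ) [NeZero k] :
    Measurable (cellIndex k : Torus n → Fin (k ^ n)) := by
  refine measurable_to_countable' fun i => ?_
  rw [cellIndex_preimage]
  exact MeasurableSet.univ_pi fun j => measurable_circleIndex k (measurableSet_singleton _)

lemma volume_cellIndex_preimage {n : ℕ} (k : ℕ) [NeZero k] (i : Fin (k ^ n)) :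
    volume (cellIndex k ⁻¹' {i} : Set (Torus n)) = ((k ^ n : ℕ) : ℝ≥0∞)⁻¹ := by
  rw [cellIndex_preimage, volume_pi_pi]
  simp only [volume_circleIndex_preimage, Finset.prod_const, Finset.card_univ, Fintype.card_fin]
  rw [Nat.cast_pow, ENNReal.inv_pow]

lemma dist_cellIndex_le {n : ℕ} (k : ℕ) [NeZero k] (z : Torus n) :
    dist z (latticePoint n k (cellIndex k z)) ≤ (k : ℝ)⁻¹ := by
  refine (dist_pi_le_iff (by positivity)).2 fun j => ?_
  simpa [latticePoint, proj, cellIndex] using dist_circleIndex_le k (z j)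

lemma map_cellIndex_volume {n : ℕ} (k : ℕ) [NeZero k] :
    (volume : Measure (Torus n)).map (cellIndex k) =
      ((k ^ n : ℕ) : ℝ≥0∞)⁻¹ • ∑ i, Measure.dirac i := by
  refine Measure.ext_of_singleton fun i => ?_
  rw [Measure.map_apply (measurable_cellIndex k) (measurableSet_singleton i),
    volume_cellIndex_preimage]
  simp [Measure.finsetSum_apply, Set.indicator_apply]

/-- The lattice points are matched to the points of a configuration by `σ`; transporting the cell of
each lattice point to the corresponding point of the configuration is a plan between the empirical
measure and `dx`. -/
lemma wassersteinSq_empiricalMeasure_le {n k : ℕ} [NeZero k] (x : Fin (k ^ n) → Torus n)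
    (σ : Equiv.Perm (Fin (k ^ n))) :
    wassersteinSq (empiricalMeasure x : Measure (Torus n)) volume ≤
      ENNReal.ofReal ((∑ j, cost (x j) (latticePoint n k (σ j))) / (k ^ n : ℕ) + n / k) := by
  let T : Torus n → Torus n × Torus n := fun z => (x (σ.symm (cellIndex k z)), z)
  have hx : Measurable fun z : Torus n => x (σ.symm (cellIndex k z)) :=
    (measurable_of_finite fun i => x (σ.symm i)).comp (measurable_cellIndex k)
  have hT : Measurable T := hx.prodMk measurable_id
  have hplan : (volume : Measure (Torus n)).map T ∈
      transportPlans (empiricalMeasure x : Measure (Torus n)) volume := by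
    constructor
    · rw [Measure.map_map measurable_fst hT]
      change (volume : Measure (Torus n)).map ((fun i => x (σ.symm i)) ∘ cellIndex k) = _
      rw [← Measure.map_map (measurable_of_finite _) (measurable_cellIndex k),
        map_cellIndex_volume, Measure.map_smul,
        ← Measure.mapₗ_apply_of_measurable (measurable_of_finite _), map_sum]
      simp only [Measure.mapₗ_apply_of_measurable (measurable_of_finite _),
        Measure.map_dirac]
      rw [Equiv.sum_comp σ.symm fun i => Measure.dirac (x i)]
      rfl
    · rw [Measure.map_map measurable_snd hT]
      exact Measure.map_id
  refine (iInf₂_le _ hplan).trans ?_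
  have hmeas : Measurable fun z : Torus n × Torus n => ENNReal.ofReal (cost z.1 z.2) :=
    continuous_cost.measurable.ennreal_ofReal
  rw [lintegral_map hmeas hT]
  have hle : ∀ z : Torus n, ENNReal.ofReal (cost (T z).1 (T z).2) ≤
      ENNReal.ofReal (cost (x (σ.symm (cellIndex k z))) (latticePoint n k (cellIndex k z)) +
        n / k) := by
    intro z
    refine ENNReal.ofReal_le_ofReal ((cost_le_cost_add _ _
      (x (σ.symm (cellIndex k z))) (latticePoint n k (cellIndex k z))).trans ?_)
    rw [dist_self, zero_add, div_eq_mul_inv]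
    gcongr
    exact dist_cellIndex_le k z
  refine (lintegral_mono hle).trans (le_of_eq ?_)
  have hcomp := lintegral_map (μ := (volume : Measure (Torus n)))
    (f := fun i : Fin (k ^ n) =>
      ENNReal.ofReal (cost (x (σ.symm i)) (latticePoint n k i) + n / k))
    (measurable_of_finite _) (measurable_cellIndex k)
  rw [← hcomp, map_cellIndex_volume, lintegral_smul_measure, lintegral_finsetSum_measure]
  simp only [lintegral_dirac]
  have hN : (0 : ℝ) < (k ^ n : ℕ) := by exact_mod_cast Nat.pos_of_ne_zero (NeZero.ne (k ^ n))
  rw [← ENNReal.ofReal_sum_of_nonneg fun i _ => add_nonneg (cost_nonneg _ _) (by positivity),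
    ← ENNReal.ofReal_natCast, ← ENNReal.ofReal_inv_of_pos hN, smul_eq_mul,
    ← ENNReal.ofReal_mul (by positivity), Finset.sum_add_distrib,
    ← Equiv.sum_comp σ fun i => cost (x (σ.symm i)) (latticePoint n k i)]
  simp only [Equiv.symm_apply_apply, Finset.sum_const, Finset.card_univ, Fintype.card_fin,
    nsmul_eq_mul]
  congr 1
  field_simp

/-! ### Bounds on the permanental measure -/

lemma lintegral_pi_prod_eq_prod {ι X : Type*} [Fintype ι] [MeasurableSpace X] (μ : Measure X)
    [IsProbabilityMeasure μ] {f : ι → X → ℝ≥0∞} (hf : ∀ i, Measurable (f i)) :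
    ∫⁻ x : ι → X, ∏ i, f i (x i) ∂(Measure.pi fun _ => μ) = ∏ i, ∫⁻ x, f i x ∂μ := by
  rw [ProbabilityTheory.lintegral_prod_eq_prod_lintegral_of_indepFun Finset.univ
    (fun i (x : ι → X) => f i (x i))
    (ProbabilityTheory.iIndepFun_pi fun i => (hf i).aemeasurable)
    fun i => (hf i).comp (measurable_pi_apply i)]
  refine Finset.prod_congr rfl fun i _ => ?_
  exact (measurePreserving_eval (fun _ : ι => μ) i).lintegral_comp (hf i)

lemma ofReal_wavePermanent {n k : ℕ} (hk : 1 ≤ k) (x : Fin (k ^ n) → Torus n) :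
    ENNReal.ofReal (wavePermanent k x) = ∑ σ : Equiv.Perm (Fin (k ^ n)),
      ∏ j, ENNReal.ofReal (waveFunction k (latticePoint n k (σ j)) (x j)) := by
  have h0 : ∀ i j, 0 ≤ waveFunction k (latticePoint n k i) (x j) := fun i j =>
    (waveFunction_pos hk _ _).le
  simp only [wavePermanent, Matrix.permanent, Matrix.of_apply]
  rw [ENNReal.ofReal_sum_of_nonneg fun σ _ => Finset.prod_nonneg fun j _ => h0 _ _]
  exact Finset.sum_congr rfl fun σ _ => ENNReal.ofReal_prod_of_nonneg fun j _ => h0 _ _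

lemma measurable_prod_waveFunction {n k : ℕ} (σ : Equiv.Perm (Fin (k ^ n))) :
    Measurable fun x : Fin (k ^ n) → Torus n =>
      ∏ j, ENNReal.ofReal (waveFunction k (latticePoint n k (σ j)) (x j)) :=
  Finset.measurable_prod _ fun j _ =>
    ((measurable_waveFunction k _).comp (measurable_pi_apply j)).ennreal_ofReal

lemma unnormalizedProcess_apply {n k : ℕ} (hk : 1 ≤ k) (μ₀ : Measure (Torus n))
    {S : Set (Fin (k ^ n) → Torus n)} (hS : MeasurableSet S) :
    unnormalizedProcess μ₀ k k S = ∫⁻ x in S, ∑ σ : Equiv.Perm (Fin (k ^ n)),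
      ∏ j, ENNReal.ofReal (waveFunction k (latticePoint n k (σ j)) (x j))
        ∂(Measure.pi fun _ => μ₀) := by
  have hk0 : (k : ℝ) ≠ 0 := by positivity
  rw [unnormalizedProcess, withDensity_apply _ hS]
  simp only [div_self hk0, Real.rpow_one, ofReal_wavePermanent hk]

/-- The density is at most `N!` times its largest term, and each term is controlled by the total
cost of the matching of the configuration with the lattice. -/
lemma unnormalizedProcess_le {n k : ℕ} (hk : 1 ≤ k) (μ₀ : Measure (Torus n))
    [IsProbabilityMeasure μ₀] {S : Set (Fin (k ^ n) → Torus n)} (hS : MeasurableSet S) {h : ℝ}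
    (hh : ∀ x ∈ S, ∀ σ : Equiv.Perm (Fin (k ^ n)),
      (k ^ n : ℕ) * h ≤ ∑ j, cost (x j) (latticePoint n k (σ j))) :
    unnormalizedProcess μ₀ k k S ≤
      ENNReal.ofReal ((k ^ n)! * (gaussConst n * Real.exp (-(k * h))) ^ (k ^ n)) := by
  have hC : 0 ≤ gaussConst n := zero_le_one.trans (one_le_gaussConst n)
  have hterm : ∀ x ∈ S, ∀ σ : Equiv.Perm (Fin (k ^ n)),
      ∏ j, ENNReal.ofReal (waveFunction k (latticePoint n k (σ j)) (x j)) ≤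
        ENNReal.ofReal ((gaussConst n * Real.exp (-(k * h))) ^ (k ^ n)) := by
    intro x hx σ
    rw [← ENNReal.ofReal_prod_of_nonneg fun j _ => (waveFunction_pos hk _ _).le]
    refine ENNReal.ofReal_le_ofReal ?_
    calc ∏ j, waveFunction k (latticePoint n k (σ j)) (x j)
        ≤ ∏ j, gaussConst n * Real.exp (-(k * cost (x j) (latticePoint n k (σ j)))) :=
          Finset.prod_le_prod (fun j _ => (waveFunction_pos hk _ _).le)
            fun j _ => (waveFunction_bounds hk _ _).2
      _ = gaussConst n ^ (k ^ n) *
            Real.exp (-(k * ∑ j, cost (x j) (latticePoint n k (σ j)))) := by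
          rw [Finset.prod_mul_distrib, Finset.prod_const, Finset.card_univ, Fintype.card_fin,
            ← Real.exp_sum, Finset.sum_neg_distrib, Finset.mul_sum]
      _ ≤ gaussConst n ^ (k ^ n) * Real.exp (-(k * ((k ^ n : ℕ) * h))) := by
          gcongr
          exact hh x hx σ
      _ = (gaussConst n * Real.exp (-(k * h))) ^ (k ^ n) := by
          rw [mul_pow, ← Real.exp_nat_mul]
          ring_nf
  rw [unnormalizedProcess_apply hk μ₀ hS]
  calc _ ≤ ∫⁻ _x in S, ENNReal.ofReal
          ((k ^ n)! * (gaussConst n * Real.exp (-(k * h))) ^ (k ^ n))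
            ∂(Measure.pi fun _ => μ₀) := by
        refine setLIntegral_mono measurable_const fun x hx => ?_
        refine (Finset.sum_le_sum fun σ _ => hterm x hx σ).trans (le_of_eq ?_)
        rw [Finset.sum_const, Finset.card_univ, Fintype.card_perm, Fintype.card_fin,
          nsmul_eq_mul, ENNReal.ofReal_mul (by positivity), ENNReal.ofReal_natCast]
    _ ≤ _ := by
        rw [setLIntegral_const]
        exact mul_le_of_le_one_right' prob_le_one

/-- Each of the `N!` terms of the density contributes the product of the masses of small balls
around the points of a matched configuration `y`. -/
lemma le_unnormalizedProcess {n k : ℕ} (hk : 1 ≤ k) (μ₀ : Measure (Torus n))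
    [IsProbabilityMeasure μ₀] {S : Set (Fin (k ^ n) → Torus n)} (hS : MeasurableSet S)
    {h δ a : ℝ} (ha : 0 ≤ a) (hball : ∀ z, ENNReal.ofReal a ≤ μ₀ (Metric.ball z δ))
    (y : Fin (k ^ n) → Torus n)
    (hy : ∑ i, cost (y i) (latticePoint n k i) ≤ (k ^ n : ℕ) * h)
    (hyS : ∀ (σ : Equiv.Perm (Fin (k ^ n))) (x : Fin (k ^ n) → Torus n),
      (∀ j, x j ∈ Metric.ball (y (σ j)) δ) → x ∈ S) :
    ENNReal.ofReal ((k ^ n)! * (a * Real.exp (-(k * (h + n * δ)))) ^ (k ^ n)) ≤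
      unnormalizedProcess μ₀ k k S := by
  rw [unnormalizedProcess_apply hk μ₀ hS,
    lintegral_finsetSum _ fun σ _ => measurable_prod_waveFunction σ]
  have hterm : ∀ σ : Equiv.Perm (Fin (k ^ n)),
      ENNReal.ofReal ((a * Real.exp (-(k * (h + n * δ)))) ^ (k ^ n)) ≤
        ∫⁻ x in S, ∏ j, ENNReal.ofReal (waveFunction k (latticePoint n k (σ j)) (x j))
          ∂(Measure.pi fun _ => μ₀) := by
    intro σ
    let b : Fin (k ^ n) → ℝ := fun i =>
      Real.exp (-(k * (cost (y i) (latticePoint n k i) + n * δ)))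
    calc ENNReal.ofReal ((a * Real.exp (-(k * (h + n * δ)))) ^ (k ^ n))
        ≤ ENNReal.ofReal (∏ i, a * b i) := by
          refine ENNReal.ofReal_le_ofReal ?_
          rw [Finset.prod_mul_distrib, Finset.prod_const, Finset.card_univ, Fintype.card_fin,
            mul_pow, ← Real.exp_sum, ← Real.exp_nat_mul]
          refine mul_le_mul_of_nonneg_left (Real.exp_le_exp.2 ?_) (by positivity)
          rw [Finset.sum_neg_distrib, ← Finset.mul_sum, Finset.sum_add_distrib, Finset.sum_const,
            Finset.card_univ, Fintype.card_fin, nsmul_eq_mul]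
          have hk0 : (0 : ℝ) ≤ k := by positivity
          have := mul_le_mul_of_nonneg_left hy hk0
          linarith
      _ = ∏ j, ENNReal.ofReal (b (σ j)) * ENNReal.ofReal a := by
          rw [ENNReal.ofReal_prod_of_nonneg fun i _ => mul_nonneg ha (Real.exp_pos _).le,
            ← Equiv.prod_comp σ]
          refine Finset.prod_congr rfl fun j _ => ?_
          rw [mul_comm, ENNReal.ofReal_mul (Real.exp_pos _).le]
      _ ≤ ∏ j, ∫⁻ x, (Metric.ball (y (σ j)) δ).indicator
            (fun x => ENNReal.ofReal (waveFunction k (latticePoint n k (σ j)) x)) x ∂μ₀ := by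
          refine Finset.prod_le_prod' fun j _ => ?_
          rw [lintegral_indicator measurableSet_ball]
          refine (mul_le_mul_right (hball (y (σ j))) _).trans ?_
          rw [← setLIntegral_const]
          refine setLIntegral_mono ((measurable_waveFunction k _).ennreal_ofReal) fun x hx => ?_
          refine ENNReal.ofReal_le_ofReal (le_trans ?_ (waveFunction_bounds hk _ _).1)
          refine Real.exp_le_exp.2 (neg_le_neg (mul_le_mul_of_nonneg_left ?_ (by positivity)))
          refine (cost_le_cost_add _ _ (y (σ j)) (latticePoint n k (σ j))).trans ?_
          rw [dist_self, add_zero]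
          gcongr
          exact (Metric.mem_ball.1 hx).le
      _ = ∫⁻ x : Fin (k ^ n) → Torus n, ∏ j, (Metric.ball (y (σ j)) δ).indicator
            (fun x => ENNReal.ofReal (waveFunction k (latticePoint n k (σ j)) x)) (x j)
              ∂(Measure.pi fun _ => μ₀) :=
          (lintegral_pi_prod_eq_prod μ₀ fun j =>
            (measurable_waveFunction k _).ennreal_ofReal.indicator measurableSet_ball).symm
      _ ≤ _ := by
          rw [← lintegral_indicator hS]
          refine lintegral_mono fun x => ?_
          by_cases hx : ∀ j, x j ∈ Metric.ball (y (σ j)) δ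
          · rw [Set.indicator_of_mem (hyS σ x hx)]
            exact Finset.prod_le_prod' fun j _ => by rw [Set.indicator_of_mem (hx j)]
          · obtain ⟨j, hj⟩ := not_forall.1 hx
            rw [Finset.prod_eq_zero (Finset.mem_univ j) (Set.indicator_of_notMem hj _)]
            exact zero_le
  refine le_trans (le_of_eq ?_) (Finset.sum_le_sum fun σ _ => hterm σ)
  rw [Finset.sum_const, Finset.card_univ, Fintype.card_perm, Fintype.card_fin,
    nsmul_eq_mul, ENNReal.ofReal_mul (by positivity), ENNReal.ofReal_natCast]

/-- The masses of balls of a given radius are bounded below on a compact space. -/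
lemma exists_pos_le_measure_ball {X : Type*} [MetricSpace X] [CompactSpace X] [Nonempty X]
    [MeasurableSpace X] (μ : Measure X) [IsProbabilityMeasure μ] [μ.IsOpenPosMeasure] {δ : ℝ}
    (hδ : 0 < δ) : ∃ a : ℝ, 0 < a ∧ ∀ z, ENNReal.ofReal a ≤ μ (Metric.ball z δ) := by
  obtain ⟨t, -, ht, hcover⟩ :=
    Metric.finite_approx_of_totallyBounded (isCompact_univ (X := X)).totallyBounded (δ / 2)
      (half_pos hδ)
  have hne : t.Nonempty := by
    obtain ⟨z⟩ := ‹Nonempty X›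
    obtain ⟨c, hc, -⟩ := Set.mem_iUnion₂.1 (hcover (Set.mem_univ z))
    exact ⟨c, hc⟩
  obtain ⟨c₀, -, hmin⟩ := t.exists_min_image (fun c => μ (Metric.ball c (δ / 2))) ht hne
  refine ⟨(μ (Metric.ball c₀ (δ / 2))).toReal, ?_, fun z => ?_⟩
  · exact ENNReal.toReal_pos (Metric.measure_ball_pos μ c₀ (half_pos hδ)).ne' (measure_ne_top _ _)
  · rw [ENNReal.ofReal_toReal (measure_ne_top _ _)]
    obtain ⟨c, hc, hz⟩ := Set.mem_iUnion₂.1 (hcover (Set.mem_univ z))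
    refine (hmin c hc).trans (measure_mono (Metric.ball_subset_ball' ?_))
    have := Metric.mem_ball'.1 hz
    linarith

lemma cost_self {n : ℕ} (x : Torus n) : cost x x = 0 := by
  simp [cost_eq]

lemma measurable_empiricalMeasure {n N : ℕ} [NeZero N] :
    Measurable (empiricalMeasure : (Fin N → Torus n) → ProbabilityMeasure (Torus n)) := by
  refine Measurable.subtype_mk (Measure.measurable_of_measurable_coe _ fun s hs => ?_)
  simp only [Measure.smul_apply, Measure.finsetSum_apply, smul_eq_mul]
  refine (Finset.measurable_sum _ fun i _ => ?_).const_mul _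
  exact ((Measure.measurable_coe hs).comp Measure.measurable_dirac).comp (measurable_pi_apply i)

lemma empiricalMeasure_comp_perm {n N : ℕ} [NeZero N] (x : Fin N → Torus n)
    (σ : Equiv.Perm (Fin N)) : empiricalMeasure (fun j => x (σ j)) = empiricalMeasure x := by
  refine Subtype.ext ?_
  simp only [empiricalMeasure]
  rw [Equiv.sum_comp σ fun i => Measure.dirac (x i)]

section Law

variable {n : ℕ} (μ₀ : Measure (Torus n)) [IsProbabilityMeasure μ₀] (k : ℕ) [NeZero k]

/-- Lower bound for the partition function, from configurations near the lattice itself. -/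
lemma le_unnormalizedProcess_univ {δ a : ℝ} (ha : 0 ≤ a)
    (hball : ∀ z, ENNReal.ofReal a ≤ μ₀ (Metric.ball z δ)) :
    ENNReal.ofReal ((k ^ n)! * (a * Real.exp (-(k * (n * δ)))) ^ (k ^ n)) ≤
      unnormalizedProcess μ₀ k k Set.univ := by
  have h := le_unnormalizedProcess (h := 0) (NeZero.one_le (n := k)) μ₀ MeasurableSet.univ ha hball
    (latticePoint n k) (by simp [cost_self]) fun _ _ _ => Set.mem_univ _
  rwa [zero_add] at h

lemma unnormalizedProcess_univ_le :
    unnormalizedProcess μ₀ k k Set.univ ≤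
      ENNReal.ofReal ((k ^ n)! * gaussConst n ^ (k ^ n)) := by
  have h := unnormalizedProcess_le (h := 0) (NeZero.one_le (n := k)) μ₀
    MeasurableSet.univ fun x _ σ => by
    rw [mul_zero]
    exact Finset.sum_nonneg fun j _ => cost_nonneg _ _
  rwa [mul_zero, neg_zero, Real.exp_zero, mul_one] at h

lemma unnormalizedProcess_univ_ne_zero [μ₀.IsOpenPosMeasure] :
    unnormalizedProcess μ₀ k k Set.univ ≠ 0 := by
  obtain ⟨a, ha, hball⟩ := exists_pos_le_measure_ball μ₀ zero_lt_one
  have hk : (0 : ℝ) < k := by exact_mod_cast Nat.pos_of_ne_zero (NeZero.ne k)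
  refine ne_of_gt (lt_of_lt_of_le ?_ (le_unnormalizedProcess_univ μ₀ k ha.le hball))
  exact ENNReal.ofReal_pos.2 (by positivity)

lemma unnormalizedProcess_univ_ne_top : unnormalizedProcess μ₀ k k Set.univ ≠ ∞ :=
  ((unnormalizedProcess_univ_le μ₀ k).trans_lt ENNReal.ofReal_lt_top).ne

/-- Bound from above for the law of the empirical measure on an event on which the rate function is
at least `g`. -/
lemma normalizedProcess_le {E : Set (ProbabilityMeasure (Torus n))} (hE : MeasurableSet E) {g : ℝ}
    (hg : ∀ μ ∈ E, ENNReal.ofReal g ≤ wassersteinSq (μ : Measure (Torus n)) volume) {δ a : ℝ}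
    (ha : 0 < a) (hball : ∀ z, ENNReal.ofReal a ≤ μ₀ (Metric.ball z δ)) :
    (unnormalizedProcess μ₀ k k Set.univ)⁻¹ *
      unnormalizedProcess μ₀ k k (empiricalMeasure ⁻¹' E) ≤
        ENNReal.ofReal (Real.exp ((k : ℝ) * (k ^ n : ℕ) *
          (-g + n * δ + (n + Real.log (gaussConst n / a)) * (k : ℝ)⁻¹))) := by
  have hk : (0 : ℝ) < k := by exact_mod_cast Nat.pos_of_ne_zero (NeZero.ne k)
  have hC := zero_lt_one.trans_le (one_le_gaussConst n)
  have hN : (0 : ℝ) < (k ^ n : ℕ) := by exact_mod_cast Nat.pos_of_ne_zero (NeZero.ne (k ^ n))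
  have hup : unnormalizedProcess μ₀ k k (empiricalMeasure ⁻¹' E) ≤ _ :=
    unnormalizedProcess_le (h := g - n / k) (NeZero.one_le (n := k)) μ₀
    (measurable_empiricalMeasure hE) fun x hx σ => by
      have h := (hg _ hx).trans (wassersteinSq_empiricalMeasure_le x σ)
      have h0 : 0 ≤ ∑ j, cost (x j) (latticePoint n k (σ j)) :=
        Finset.sum_nonneg fun j _ => cost_nonneg _ _
      rw [ENNReal.ofReal_le_ofReal_iff (by positivity)] at h
      rw [mul_comm, ← le_div_iff₀ hN]
      linarith
  refine (mul_le_mul' (ENNReal.inv_le_inv.2 (le_unnormalizedProcess_univ μ₀ k ha.le hball))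
    hup).trans (le_of_eq ?_)
  rw [← ENNReal.ofReal_inv_of_pos (by positivity), ← ENNReal.ofReal_mul (by positivity)]
  congr 1
  have hexp : ∀ b : ℝ, Real.exp ((k : ℝ) * (k ^ n : ℕ) * b) =
      Real.exp ((k : ℝ) * b) ^ (k ^ n) := fun b => by
    rw [← Real.exp_nat_mul]
    ring_nf
  rw [hexp, mul_inv, mul_mul_mul_comm, inv_mul_cancel₀ (by positivity), one_mul, ← inv_pow,
    ← mul_pow]
  congr 1
  rw [show (k : ℝ) * (-g + n * δ + (n + Real.log (gaussConst n / a)) * (k : ℝ)⁻¹) =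
    -((k : ℝ) * (g - n / (k : ℝ))) + (k : ℝ) * (n * δ) + Real.log (gaussConst n / a) by
      field_simp
      ring, Real.exp_add, Real.exp_add, Real.exp_log (by positivity), Real.exp_neg
      ((k : ℝ) * (n * δ))]
  field_simp

/-- Bound from below for the law of the empirical measure on an event which contains the empirical
measures of all configurations `δ`-close to a configuration `y` of mean matching cost at most `h`.
-/
lemma le_normalizedProcess {E : Set (ProbabilityMeasure (Torus n))} (hE : MeasurableSet E)
    {h δ a : ℝ}
    (ha : 0 < a) (hball : ∀ z, ENNReal.ofReal a ≤ μ₀ (Metric.ball z δ))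
    (y : Fin (k ^ n) → Torus n)
    (hy : ∑ i, cost (y i) (latticePoint n k i) ≤ (k ^ n : ℕ) * h)
    (hyE : ∀ x : Fin (k ^ n) → Torus n,
      (∀ j, x j ∈ Metric.ball (y j) δ) → empiricalMeasure x ∈ E) :
    ENNReal.ofReal (Real.exp ((k : ℝ) * (k ^ n : ℕ) *
      (-h - n * δ - Real.log (gaussConst n / a) * (k : ℝ)⁻¹))) ≤
      (unnormalizedProcess μ₀ k k Set.univ)⁻¹ *
        unnormalizedProcess μ₀ k k (empiricalMeasure ⁻¹' E) := by
  have hk : (0 : ℝ) < k := by exact_mod_cast Nat.pos_of_ne_zero (NeZero.ne k)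
  have hC := zero_lt_one.trans_le (one_le_gaussConst n)
  have hlow : _ ≤ unnormalizedProcess μ₀ k k (empiricalMeasure ⁻¹' E) :=
    le_unnormalizedProcess (NeZero.one_le (n := k)) μ₀ (measurable_empiricalMeasure hE)
    ha.le hball y hy fun σ x hx => by
      have h := hyE (fun j => x (σ.symm j)) fun j => by
        simpa only [Equiv.apply_symm_apply] using hx (σ.symm j)
      rwa [empiricalMeasure_comp_perm x σ.symm] at h
  refine le_trans (le_of_eq ?_)
    (mul_le_mul' (ENNReal.inv_le_inv.2 (unnormalizedProcess_univ_le μ₀ k)) hlow)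
  rw [← ENNReal.ofReal_inv_of_pos (by positivity), ← ENNReal.ofReal_mul (by positivity)]
  congr 1
  have hexp : ∀ b : ℝ, Real.exp ((k : ℝ) * (k ^ n : ℕ) * b) =
      Real.exp ((k : ℝ) * b) ^ (k ^ n) := fun b => by
    rw [← Real.exp_nat_mul]
    ring_nf
  rw [hexp, mul_inv, mul_mul_mul_comm, inv_mul_cancel₀ (by positivity), one_mul, ← inv_pow,
    ← mul_pow]
  congr 1
  rw [show (k : ℝ) * (-h - n * δ - Real.log (gaussConst n / a) * (k : ℝ)⁻¹) =
    -((k : ℝ) * (h + n * δ)) - Real.log (gaussConst n / a) by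
      field_simp
      ring, Real.exp_sub, Real.exp_log (by positivity)]
  field_simp

end Law

lemma empiricalLaw_apply {n : ℕ} (μ₀ : Measure (Torus n)) (k : ℕ+) (β : ℝ)
    {E : Set (ProbabilityMeasure (Torus n))} (hE : MeasurableSet E) :
    empiricalLaw μ₀ k β E = (unnormalizedProcess μ₀ k β Set.univ)⁻¹ *
      unnormalizedProcess μ₀ k β (empiricalMeasure ⁻¹' E) := by
  rw [empiricalLaw, Measure.map_apply measurable_empiricalMeasure hE, pointProcess,
    Measure.smul_apply, smul_eq_mul]

/-! ### Weak neighbourhoods and empirical averages -/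

/-- A basic neighbourhood for the weak topology: finitely many test functions, one tolerance. -/
lemma exists_finset_test_of_mem_nhds {X : Type*} [TopologicalSpace X] [MeasurableSpace X]
    [OpensMeasurableSpace X] {μ : ProbabilityMeasure X} {U : Set (ProbabilityMeasure X)}
    (hU : U ∈ 𝓝 μ) : ∃ (I : Finset (X →ᵇ ℝ)) (ε : ℝ), 0 < ε ∧ ∀ ν : ProbabilityMeasure X,
      (∀ f ∈ I, |∫ x, f x ∂(ν : Measure X) - ∫ x, f x ∂(μ : Measure X)| < ε) → ν ∈ U := by
  have hle : (⨅ f : X →ᵇ ℝ, comap (fun ν : ProbabilityMeasure X => ∫ x, f x ∂(ν : Measure X))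
      (𝓝 (∫ x, f x ∂(μ : Measure X)))) ≤ 𝓝 μ := by
    refine tendsto_id'.1 (ProbabilityMeasure.tendsto_iff_forall_integral_tendsto.2 fun f => ?_)
    exact tendsto_comap.mono_left (iInf_le _ f)
  have hbasis := HasBasis.iInf fun f : X →ᵇ ℝ => (Metric.nhds_basis_ball
    (x := ∫ x, f x ∂(μ : Measure X))).comap
      fun ν : ProbabilityMeasure X => ∫ x, f x ∂(ν : Measure X)
  obtain ⟨⟨I, r⟩, ⟨hI, hr⟩, hIU⟩ := hbasis.mem_iff.1 (hle hU)
  have hev : ∀ᶠ ε in 𝓝[>] (0 : ℝ), ∀ i : I, ε < r i := by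
    have : Finite I := hI
    exact eventually_all.2 fun i => nhdsWithin_le_nhds (gt_mem_nhds (hr i))
  obtain ⟨ε, hε, hε0⟩ := (hev.and self_mem_nhdsWithin).exists
  refine ⟨hI.toFinset, ε, hε0, fun ν hν => hIU (Set.mem_iInter.2 fun f => ?_)⟩
  exact (hν f (hI.mem_toFinset.2 f.2)).trans (hε f)

lemma integral_empiricalMeasure {n N : ℕ} [NeZero N] (y : Fin N → Torus n)
    (f : Torus n →ᵇ ℝ) :
    ∫ x, f x ∂(empiricalMeasure y : Measure (Torus n)) = (∑ i, f (y i)) / N := by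
  change ∫ x, f x ∂((N : ℝ≥0∞)⁻¹ • ∑ i, Measure.dirac (y i)) = _
  rw [integral_smul_measure, integral_finsetSum_measure fun i _ => f.integrable _]
  simp [div_eq_inv_mul]

/-- A neighbourhood of `μ` contains the empirical measures of all small perturbations of the
configurations whose averages of finitely many test functions are close to those of `μ`. -/
lemma exists_test_of_mem_nhds {n : ℕ} {μ : ProbabilityMeasure (Torus n)}
    {U : Set (ProbabilityMeasure (Torus n))} (hU : U ∈ 𝓝 μ) :
    ∃ (I : Finset (Torus n →ᵇ ℝ)) (ε : ℝ), 0 < ε ∧ ∀ᶠ δ in 𝓝[>] (0 : ℝ),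
      ∀ (N : ℕ) [NeZero N] (y : Fin N → Torus n),
        (∀ f ∈ I, |(∑ i, f (y i)) / N - ∫ x, f x ∂(μ : Measure (Torus n))| < ε) →
          ∀ x : Fin N → Torus n, (∀ j, x j ∈ Metric.ball (y j) δ) → empiricalMeasure x ∈ U := by
  obtain ⟨I, ε, hε, hI⟩ := exists_finset_test_of_mem_nhds hU
  refine ⟨I, ε / 2, half_pos hε, ?_⟩
  have hev : ∀ f ∈ I, ∀ᶠ δ in 𝓝[>] (0 : ℝ), ∀ x y : Torus n, dist x y < δ →
      |f x - f y| ≤ ε / 2 := by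
    intro f _
    obtain ⟨δ₀, hδ₀, h⟩ := Metric.uniformContinuous_iff.1
      (CompactSpace.uniformContinuous_of_continuous f.continuous) (ε / 2) (half_pos hε)
    filter_upwards [nhdsWithin_le_nhds (gt_mem_nhds hδ₀)] with δ hδ x y hxy
    exact (h (hxy.trans hδ)).le
  filter_upwards [(Finset.eventually_all I).2 hev] with δ hδ N _ y hy x hx
  refine hI _ fun f hf => ?_
  rw [integral_empiricalMeasure]
  have hN : (0 : ℝ) < N := by exact_mod_cast Nat.pos_of_ne_zero (NeZero.ne N)
  have h1 : |(∑ i, f (x i)) / N - (∑ i, f (y i)) / N| ≤ ε / 2 := by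
    rw [← sub_div, ← Finset.sum_sub_distrib, abs_div, abs_of_pos hN, div_le_iff₀ hN]
    refine (Finset.abs_sum_le_sum_abs _ _).trans ?_
    refine (Finset.sum_le_sum fun i _ => hδ f hf (x i) (y i) (hx i)).trans (le_of_eq ?_)
    simp [mul_comm]
  have h2 := abs_sub_le ((∑ i, f (x i)) / N) ((∑ i, f (y i)) / N)
    (∫ x, f x ∂(μ : Measure (Torus n)))
  have h3 := hy f hf
  linarith

/-! ### Sampling a transport plan -/

/-- For independent `y_i` of laws `ν_i`, the expectation of the mean cost plus `K` times the squared
deviations of the averages of the test functions is at most the right hand side; some value of the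
random configuration does not exceed the expectation. -/
lemma exists_configuration_le {X : Type*} [TopologicalSpace X] [MeasurableSpace X] [BorelSpace X]
    {N : ℕ} [NeZero N] (ν : Fin N → Measure X) [∀ i, IsProbabilityMeasure (ν i)]
    (c : Fin N → X →ᵇ ℝ) (I : Finset (X →ᵇ ℝ)) {K : ℝ} (hK : 0 ≤ K) :
    ∃ y : Fin N → X, (∑ i, c i (y i)) / N +
        K * ∑ f ∈ I, ((∑ i, f (y i)) / N - (∑ i, ∫ x, f x ∂ν i) / N) ^ 2 ≤
      (∑ i, ∫ x, c i x ∂ν i) / N + K * (∑ f ∈ I, ‖f‖ ^ 2) / N := by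
  have hN : (0 : ℝ) < N := by exact_mod_cast Nat.pos_of_ne_zero (NeZero.ne N)
  have hint : ∀ (f : X →ᵇ ℝ) (i : Fin N), Integrable (fun y : Fin N → X => f (y i))
      (Measure.pi ν) := fun f i =>
    (measurePreserving_eval ν i).integrable_comp_of_integrable (f.integrable (ν i))
  have hLp : ∀ (f : X →ᵇ ℝ) (i : Fin N), MemLp f 2 (ν i) := fun f i =>
    MemLp.of_bound f.continuous.measurable.aestronglyMeasurable ‖f‖
      (ae_of_all _ f.norm_coe_le_norm)
  have heval : ∀ (f : X →ᵇ ℝ) (i : Fin N),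
      ∫ y : Fin N → X, f (y i) ∂(Measure.pi ν) = ∫ x, f x ∂ν i := fun f i =>
    integral_comp_eval f.continuous.measurable.aestronglyMeasurable
  have hsumLp : ∀ f : X →ᵇ ℝ, MemLp (fun y : Fin N → X => ∑ i, f (y i)) 2 (Measure.pi ν) :=
    fun f => memLp_finsetSum _ fun i _ =>
      (hLp f i).comp_measurePreserving (measurePreserving_eval ν i)
  have hdev : ∀ f : X →ᵇ ℝ, Integrable (fun y : Fin N → X =>
      ((∑ i, f (y i)) / N - (∑ i, ∫ x, f x ∂ν i) / N) ^ 2) (Measure.pi ν) := by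
    intro f
    have h := ((hsumLp f).sub (memLp_const (∑ i, ∫ x, f x ∂ν i))).integrable_sq.div_const
      ((N : ℝ) ^ 2)
    refine h.congr (ae_of_all _ fun y => ?_)
    simp only [Pi.sub_apply]
    rw [← sub_div, div_pow]
  have hvar : ∀ f : X →ᵇ ℝ, ∫ y : Fin N → X,
      ((∑ i, f (y i)) / N - (∑ i, ∫ x, f x ∂ν i) / N) ^ 2 ∂(Measure.pi ν) ≤ ‖f‖ ^ 2 / N := by
    intro f
    have h1 := ProbabilityTheory.variance_sum_pi (X := fun _ => f) (hLp f)
    rw [ProbabilityTheory.variance_eq_integral (by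
      simpa only [Finset.sum_fn] using (hsumLp f).aestronglyMeasurable.aemeasurable)] at h1
    simp only [Finset.sum_apply] at h1
    rw [integral_finsetSum _ fun i _ => hint f i] at h1
    simp only [heval] at h1
    have h2 : ∀ i, ProbabilityTheory.variance f (ν i) ≤ ‖f‖ ^ 2 := fun i => by
      have h := ProbabilityTheory.variance_le_sq_of_bounded (μ := ν i) (X := f) (a := -‖f‖)
        (b := ‖f‖) (ae_of_all _ fun x => abs_le.1 (f.norm_coe_le_norm x))
        f.continuous.measurable.aemeasurable
      rwa [sub_neg_eq_add, add_self_div_two] at h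
    have h3 : ∑ i, ProbabilityTheory.variance f (ν i) ≤ N * ‖f‖ ^ 2 := by
      refine (Finset.sum_le_sum fun i _ => h2 i).trans (le_of_eq ?_)
      simp
    simp_rw [← sub_div, div_pow]
    rw [integral_div, h1, div_le_div_iff₀ (by positivity) hN]
    nlinarith
  have hcost : Integrable (fun y : Fin N → X => (∑ i, c i (y i)) / N) (Measure.pi ν) :=
    (integrable_finsetSum _ fun i _ => hint (c i) i).div_const _
  have hsq : Integrable (fun y : Fin N → X =>
      K * ∑ f ∈ I, ((∑ i, f (y i)) / N - (∑ i, ∫ x, f x ∂ν i) / N) ^ 2) (Measure.pi ν) :=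
    (integrable_finsetSum _ fun f _ => hdev f).const_mul K
  obtain ⟨y, hy⟩ := exists_le_integral (hcost.add hsq)
  refine ⟨y, hy.trans ?_⟩
  simp only [Pi.add_apply]
  rw [integral_add hcost hsq, integral_div, integral_finsetSum _ fun i _ => hint (c i) i,
    integral_const_mul, integral_finsetSum _ fun f _ => hdev f, mul_div_assoc, Finset.sum_div I]
  simp only [heval]
  gcongr
  exact hvar _

/-- The conditional law of the first component of a plan, given that the second one lies in the
cell of index `i`. -/
noncomputable def cellLaw {n : ℕ} (k : ℕ) [NeZero k] (γ : Measure (Torus n × Torus n))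
    (i : Fin (k ^ n)) : Measure (Torus n) :=
  ((k ^ n : ℕ) : ℝ≥0∞) • (γ.restrict {z | cellIndex k z.2 = i}).map Prod.fst

section CellLaw

variable {n k : ℕ} [NeZero k] {γ : Measure (Torus n × Torus n)}

lemma measurableSet_cellIndex_snd (i : Fin (k ^ n)) :
    MeasurableSet {z : Torus n × Torus n | cellIndex k z.2 = i} :=
  ((measurable_cellIndex k).comp measurable_snd) (measurableSet_singleton i)

lemma isProbabilityMeasure_cellLaw (hγ : γ.map Prod.snd = volume) (i : Fin (k ^ n)) :
    IsProbabilityMeasure (cellLaw k γ i) := by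
  constructor
  rw [cellLaw, Measure.smul_apply, Measure.map_apply measurable_fst MeasurableSet.univ,
    Set.preimage_univ, Measure.restrict_apply_univ]
  have h : γ {z | cellIndex k z.2 = i} = γ.map Prod.snd (cellIndex k ⁻¹' {i}) :=
    (Measure.map_apply measurable_snd (measurable_cellIndex k (measurableSet_singleton i))).symm
  rw [h, hγ, volume_cellIndex_preimage, smul_eq_mul]
  exact ENNReal.mul_inv_cancel (Nat.cast_ne_zero.2 (NeZero.ne _)) (ENNReal.natCast_ne_top _)

/-- The average of the cell laws is the first marginal of the plan, here with a test function that
may depend on the cell. -/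
lemma sum_integral_cellLaw [IsFiniteMeasure γ] (f : Fin (k ^ n) → Torus n →ᵇ ℝ) :
    ∑ i, ∫ x, f i x ∂cellLaw k γ i =
      (k ^ n : ℕ) * ∫ z, f (cellIndex k z.2) z.1 ∂γ := by
  have hmeas : ∀ i, Measurable fun z : Torus n × Torus n => f i z.1 := fun i =>
    (f i).continuous.measurable.comp measurable_fst
  have hint : ∀ i, Integrable (fun z : Torus n × Torus n => f i z.1) γ := fun i =>
    Integrable.of_bound (hmeas i).aestronglyMeasurable ‖f i‖
      (ae_of_all _ fun z => (f i).norm_coe_le_norm z.1)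
  have h1 : ∀ i, ∫ x, f i x ∂cellLaw k γ i =
      (k ^ n : ℕ) * ∫ z in {z | cellIndex k z.2 = i}, f (cellIndex k z.2) z.1 ∂γ := by
    intro i
    rw [cellLaw, integral_smul_measure, integral_map measurable_fst.aemeasurable
      (f i).continuous.measurable.aestronglyMeasurable, ENNReal.toReal_natCast, smul_eq_mul]
    congr 1
    refine setIntegral_congr_fun (measurableSet_cellIndex_snd i) fun z hz => ?_
    rw [Set.mem_ofPred_eq] at hz
    simp only [hz]
  simp only [h1]
  rw [← Finset.mul_sum, ← integral_iUnion_fintype (fun i => measurableSet_cellIndex_snd i)]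
  · rw [show (⋃ i, {z : Torus n × Torus n | cellIndex k z.2 = i}) = Set.univ from
      Set.eq_univ_of_forall fun z => Set.mem_iUnion.2 ⟨_, rfl⟩, Measure.restrict_univ]
  · intro i j hij
    refine Set.disjoint_left.2 fun z hz hz' => hij ?_
    exact (Set.mem_ofPred_eq ▸ hz).symm.trans hz'
  · intro i
    refine (hint i).integrableOn.congr_fun (fun z hz => ?_) (measurableSet_cellIndex_snd i)
    rw [Set.mem_ofPred_eq] at hz
    simp only [hz]

end CellLaw

/-- The cost of transport to a given point, as a bounded continuous function. -/
noncomputable def costTo {n : ℕ} (p : Torus n) : Torus n →ᵇ ℝ :=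
  BoundedContinuousFunction.mkOfCompact
    ⟨fun x => cost x p, continuous_cost.comp (continuous_id.prodMk continuous_const)⟩

lemma exists_plan_integral_cost_lt {n : ℕ} {μ : Measure (Torus n)} [IsProbabilityMeasure μ] {g : ℝ}
    (hg : wassersteinSq μ volume < ENNReal.ofReal g) : ∃ γ : Measure (Torus n × Torus n),
      IsProbabilityMeasure γ ∧ γ.map Prod.fst = μ ∧ γ.map Prod.snd = volume ∧
        ∫ z, cost z.1 z.2 ∂γ < g := by
  obtain ⟨γ, hγ⟩ := iInf_lt_iff.1 hg
  obtain ⟨⟨h1, h2⟩, h3⟩ := iInf_lt_iff.1 hγ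
  have hprob : IsProbabilityMeasure γ := by
    constructor
    have := congrArg (fun m => m Set.univ) h1
    simpa [Measure.map_apply measurable_fst MeasurableSet.univ] using this
  refine ⟨γ, hprob, h1, h2, ?_⟩
  rw [integral_eq_lintegral_of_nonneg_ae (ae_of_all _ fun z => cost_nonneg _ _)
    continuous_cost.measurable.aestronglyMeasurable]
  have h4 := (ENNReal.toReal_lt_toReal (h3.trans ENNReal.ofReal_lt_top).ne
    ENNReal.ofReal_ne_top).2 h3
  rwa [ENNReal.toReal_ofReal] at h4
  by_contra hneg
  rw [ENNReal.ofReal_of_nonpos (not_le.1 hneg).le] at h3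
  exact not_lt_zero h3

/-- If the optimal cost from `μ` to `dx` is less than `g`, then on every sufficiently fine lattice
there is a configuration matched to the lattice at mean cost at most `g` whose empirical
averages approximate the integrals with respect to `μ`. -/
lemma eventually_exists_configuration {n : ℕ} {μ : ProbabilityMeasure (Torus n)} {g : ℝ}
    (hg : wassersteinSq (μ : Measure (Torus n)) volume < ENNReal.ofReal g)
    (I : Finset (Torus n →ᵇ ℝ)) {ε : ℝ} (hε : 0 < ε) :
    ∀ᶠ k : ℕ in atTop, ∀ _ : NeZero k, ∃ y : Fin (k ^ n) → Torus n,
      ∑ i, cost (y i) (latticePoint n k i) ≤ (k ^ n : ℕ) * g ∧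
        ∀ f ∈ I, |(∑ i, f (y i)) / (k ^ n : ℕ) - ∫ x, f x ∂(μ : Measure (Torus n))| < ε := by
  have hg0 : 0 < g := ENNReal.ofReal_pos.1 (pos_of_gt hg)
  rcases Nat.eq_zero_or_pos n with rfl | hn
  · -- On a one-point space nothing is random.
    refine Eventually.of_forall fun k _ => ⟨fun _ => 0, ?_, fun f _ => ?_⟩
    · simp [cost_eq, hg0.le]
    · have hf : ∀ x, f x = f 0 := fun x => congrArg f (Subsingleton.elim _ _)
      simp only [hf, Finset.sum_const, Finset.card_univ, Fintype.card_fin, nsmul_eq_mul,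
        integral_const, probReal_univ, one_smul]
      rwa [mul_div_cancel_left₀ _ (Nat.cast_ne_zero.2 (NeZero.ne (k ^ 0))), sub_self, abs_zero]
  obtain ⟨γ, hprob, h1, h2, h3⟩ := exists_plan_integral_cost_lt hg
  set c₀ := ∫ z, cost z.1 z.2 ∂γ with hc₀
  -- With this weight, an excess of a squared deviation over `ε ^ 2` would cost more than `g`.
  let K : ℝ := g / ε ^ 2 + 1
  have hK : 0 < K := by positivity
  have hlim : Tendsto (fun k : ℕ => (n + K * ∑ f ∈ I, ‖f‖ ^ 2) / (k : ℝ)) atTop (𝓝 0) :=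
    tendsto_const_div_atTop_nhds_zero_nat _
  filter_upwards [hlim.eventually_lt_const (sub_pos.2 h3)] with k hk hk0
  have hprobs := fun i => isProbabilityMeasure_cellLaw (k := k) h2 i
  have hkpos : 0 < k := Nat.pos_of_ne_zero hk0.ne
  have hk' : (0 : ℝ) < k := by exact_mod_cast hkpos
  have hN : (0 : ℝ) < (k ^ n : ℕ) := by positivity
  have hkN : (k : ℝ) ≤ (k ^ n : ℕ) := by exact_mod_cast Nat.le_self_pow hn.ne' k
  obtain ⟨y, hy⟩ := exists_configuration_le (cellLaw k γ)
    (fun i => costTo (latticePoint n k i)) I hK.le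
  rw [sum_integral_cellLaw, mul_div_cancel_left₀ _ hN.ne'] at hy
  have hmean : ∀ f : Torus n →ᵇ ℝ, (∑ i, ∫ x, f x ∂cellLaw k γ i) / (k ^ n : ℕ) =
      ∫ x, f x ∂(μ : Measure (Torus n)) := by
    intro f
    rw [sum_integral_cellLaw fun _ => f, mul_div_cancel_left₀ _ hN.ne', ← h1,
      integral_map measurable_fst.aemeasurable f.continuous.measurable.aestronglyMeasurable]
  simp only [hmean] at hy
  have hcostint : ∫ z, costTo (latticePoint n k (cellIndex k z.2)) z.1 ∂γ ≤ c₀ + n / k := by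
    have hint : Integrable (fun z : Torus n × Torus n => cost z.1 z.2) γ :=
      Integrable.of_bound continuous_cost.measurable.aestronglyMeasurable n
        (ae_of_all _ fun z => by
          rw [Real.norm_of_nonneg (cost_nonneg _ _)]
          exact cost_le _ _)
    have h4 : c₀ + n / k = ∫ z, (cost z.1 z.2 + n / k) ∂γ := by
      rw [integral_add hint (integrable_const _)]
      simp [hc₀]
    rw [h4]
    refine integral_mono_of_nonneg (ae_of_all _ fun z => cost_nonneg _ _)
      (hint.add (integrable_const _)) (ae_of_all _ fun z => ?_)
    refine (cost_le_cost_add _ _ z.1 z.2).trans ?_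
    rw [dist_self, zero_add, div_eq_mul_inv, dist_comm]
    simp only
    gcongr
    exact dist_cellIndex_le k z.2
  have hbound : K * (∑ f ∈ I, ‖f‖ ^ 2) / (k ^ n : ℕ) ≤ K * (∑ f ∈ I, ‖f‖ ^ 2) / k := by
    gcongr
  rw [add_div] at hk
  have hcosts : 0 ≤ (∑ i, cost (y i) (latticePoint n k i)) / (k ^ n : ℕ) :=
    div_nonneg (Finset.sum_nonneg fun i _ => cost_nonneg _ _) hN.le
  have hdevs : 0 ≤ ∑ f ∈ I, ((∑ i, f (y i)) / (k ^ n : ℕ) -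
      ∫ x, f x ∂(μ : Measure (Torus n))) ^ 2 := Finset.sum_nonneg fun _ _ => sq_nonneg _
  have htotal : (∑ i, cost (y i) (latticePoint n k i)) / (k ^ n : ℕ) +
      K * ∑ f ∈ I, ((∑ i, f (y i)) / (k ^ n : ℕ) - ∫ x, f x ∂(μ : Measure (Torus n))) ^ 2 ≤ g := by
    refine hy.trans ?_
    linarith
  refine ⟨y, ?_, fun f hf => ?_⟩
  · rw [← div_le_iff₀' hN]
    have := mul_nonneg hK.le hdevs
    linarith
  · have hsingle := Finset.single_le_sum (f := fun f : Torus n →ᵇ ℝ =>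
      ((∑ i, f (y i)) / (k ^ n : ℕ) - ∫ x, f x ∂(μ : Measure (Torus n))) ^ 2)
      (fun _ _ => sq_nonneg _) hf
    refine abs_lt_of_sq_lt_sq ?_ hε.le
    refine hsingle.trans_lt ?_
    have hKg : g < K * ε ^ 2 := by
      simp only [K]
      rw [add_mul, div_mul_cancel₀ _ (by positivity)]
      have := sq_pos_of_pos hε
      linarith
    have : K * (∑ f ∈ I, ((∑ i, f (y i)) / (k ^ n : ℕ) -
      ∫ x, f x ∂(μ : Measure (Torus n))) ^ 2) < K * ε ^ 2 := by linarith
    exact lt_of_mul_lt_mul_left this hK.le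

/-! ### The large deviation bounds -/

lemma log_ofReal_exp_mul_div {r : ℝ} (hr : 0 < r) (b : ℝ) :
    ENNReal.log (ENNReal.ofReal (Real.exp (r * b))) / (r : EReal) = (b : EReal) := by
  rw [ENNReal.log_ofReal_of_pos (Real.exp_pos _), Real.log_exp, ← EReal.coe_div,
    mul_div_cancel_left₀ _ hr.ne']

lemma log_div_le {r b : ℝ} (hr : 0 < r) {p : ℝ≥0∞}
    (h : p ≤ ENNReal.ofReal (Real.exp (r * b))) : ENNReal.log p / (r : EReal) ≤ b := by
  rw [← log_ofReal_exp_mul_div hr b]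
  exact EReal.div_le_div_right_of_nonneg (by exact_mod_cast hr.le) (ENNReal.log_le_log h)

lemma le_log_div {r b : ℝ} (hr : 0 < r) {p : ℝ≥0∞}
    (h : ENNReal.ofReal (Real.exp (r * b)) ≤ p) : (b : EReal) ≤ ENNReal.log p / (r : EReal) := by
  rw [← log_ofReal_exp_mul_div hr b]
  exact EReal.div_le_div_right_of_nonneg (by exact_mod_cast hr.le) (ENNReal.log_le_log h)

lemma rate_pos (n : ℕ) (k : ℕ+) : (0 : ℝ) < ((k : ℕ) : ℝ) * (((k : ℕ) ^ n : ℕ) : ℝ) := by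
  have hk : 0 < (k : ℕ) := k.pos
  positivity

lemma tendsto_coe_pnat_atTop : Tendsto (fun k : ℕ+ => (k : ℕ)) atTop atTop :=
  tendsto_atTop.2 fun b => (eventually_ge_atTop b.succPNat).mono fun _ hk =>
    (Nat.le_succ b).trans (PNat.coe_le_coe _ _ |>.2 hk)

lemma tendsto_const_mul_inv_pnat (c : ℝ) :
    Tendsto (fun k : ℕ+ => c * ((k : ℕ) : ℝ)⁻¹) atTop (𝓝 0) := by
  simpa using (tendsto_inv_atTop_nhds_zero_nat.comp tendsto_coe_pnat_atTop).const_mul c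

lemma tendsto_rate (n : ℕ) :
    Tendsto (fun k : ℕ+ => ((k : ℕ) : ℝ) * (((k : ℕ) ^ n : ℕ) : ℝ)) atTop atTop := by
  refine tendsto_atTop_mono (fun k => ?_)
    (tendsto_natCast_atTop_atTop.comp tendsto_coe_pnat_atTop)
  have h : (1 : ℝ) ≤ ((k : ℕ) ^ n : ℕ) := by exact_mod_cast Nat.one_le_pow n k k.pos
  exact le_mul_of_one_le_right (Nat.cast_nonneg _) h

section Bounds

variable {n : ℕ} (μ₀ : Measure (Torus n)) [IsProbabilityMeasure μ₀]

/-- The upper bound holds with the infimum over `E` itself, since the estimate of the density is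
pointwise. -/
lemma limsup_log_empiricalLaw_le [μ₀.IsOpenPosMeasure] {E : Set (ProbabilityMeasure (Torus n))}
    (hE : MeasurableSet E) :
    limsup (fun k : ℕ+ => ENNReal.log (empiricalLaw μ₀ k ((k : ℕ) : ℝ) E) /
        ((((k : ℕ) : ℝ) * (((k : ℕ) ^ n : ℕ) : ℝ) : ℝ) : EReal)) atTop ≤
      -⨅ μ ∈ E, ((wassersteinSq (μ : Measure (Torus n)) volume : ℝ≥0∞) : EReal) := by
  rcases E.eq_empty_or_nonempty with rfl | ⟨μ₁, hμ₁⟩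
  · refine limsup_le_of_le (h := Eventually.of_forall fun k => ?_)
    rw [measure_empty, ENNReal.log_zero, EReal.bot_div_of_pos_ne_top
      (by exact_mod_cast rate_pos n k) (EReal.coe_ne_top _)]
    exact bot_le
  let g : ℝ := (⨅ μ ∈ E, wassersteinSq (μ : Measure (Torus n)) volume).toReal
  have hfin : ⨅ μ ∈ E, wassersteinSq (μ : Measure (Torus n)) volume ≠ ∞ :=
    ((iInf₂_le μ₁ hμ₁).trans_lt (wassersteinSq_ne_top _).lt_top).ne
  have hg : ∀ μ ∈ E, ENNReal.ofReal g ≤ wassersteinSq (μ : Measure (Torus n)) volume := by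
    intro μ hμ
    rw [ENNReal.ofReal_toReal hfin]
    exact iInf₂_le μ hμ
  have hinf : ⨅ μ ∈ E, ((wassersteinSq (μ : Measure (Torus n)) volume : ℝ≥0∞) : EReal) ≤ g := by
    refine EReal.le_of_forall_lt_iff_le.1 fun t ht => ?_
    have hg0 : 0 ≤ g := ENNReal.toReal_nonneg
    have hlt : ⨅ μ ∈ E, wassersteinSq (μ : Measure (Torus n)) volume < ENNReal.ofReal t := by
      rw [← ENNReal.ofReal_toReal hfin]
      exact (ENNReal.ofReal_lt_ofReal_iff_of_nonneg hg0).2 (by exact_mod_cast ht)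
    obtain ⟨μ, hμ⟩ := iInf_lt_iff.1 hlt
    obtain ⟨hμE, hμ⟩ := iInf_lt_iff.1 hμ
    refine (iInf₂_le μ hμE).trans ?_
    have h := EReal.coe_ennreal_le_coe_ennreal_iff.2 hμ.le
    rwa [EReal.coe_ennreal_ofReal, max_eq_left (hg0.trans (by exact_mod_cast ht.le))] at h
  refine le_trans ?_ (EReal.neg_le_neg_iff.2 hinf)
  refine EReal.le_of_forall_lt_iff_le.1 fun t ht => ?_
  have ht' : 0 < t + g := by
    have : -g < t := by exact_mod_cast ht
    linarith
  -- Balls of radius `δ` around the lattice points lose a factor `exp (-k N n δ)` in the partition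
  -- function.
  obtain ⟨δ, hδ, hδt⟩ : ∃ δ : ℝ, 0 < δ ∧ n * δ < t + g := by
    refine ⟨(t + g) / (n + 1), by positivity, ?_⟩
    rw [← mul_div_assoc, div_lt_iff₀ (by positivity)]
    nlinarith
  obtain ⟨a, ha, hball⟩ := exists_pos_le_measure_ball μ₀ hδ
  refine limsup_le_of_le (h := ?_)
  filter_upwards [(tendsto_const_mul_inv_pnat (n + Real.log (gaussConst n / a))).eventually_lt_const
    (sub_pos.2 hδt)] with k hk
  refine (log_div_le (rate_pos n k) ?_).trans (EReal.coe_le_coe_iff.2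
    (show -g + n * δ + (n + Real.log (gaussConst n / a)) * ((k : ℕ) : ℝ)⁻¹ ≤ t by linarith))
  rw [empiricalLaw_apply μ₀ k _ hE]
  exact normalizedProcess_le μ₀ k hE hg ha hball

lemma le_liminf_log_empiricalLaw [μ₀.IsOpenPosMeasure] {E : Set (ProbabilityMeasure (Torus n))}
    (hE : MeasurableSet E) {μ : ProbabilityMeasure (Torus n)} (hμ : E ∈ 𝓝 μ) :
    -((wassersteinSq (μ : Measure (Torus n)) volume : ℝ≥0∞) : EReal) ≤
      liminf (fun k : ℕ+ => ENNReal.log (empiricalLaw μ₀ k ((k : ℕ) : ℝ) E) /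
        ((((k : ℕ) : ℝ) * (((k : ℕ) ^ n : ℕ) : ℝ) : ℝ) : EReal)) atTop := by
  have hfin := wassersteinSq_ne_top (μ : Measure (Torus n))
  obtain ⟨w, hw0, hw⟩ : ∃ w : ℝ, 0 ≤ w ∧
      wassersteinSq (μ : Measure (Torus n)) volume = ENNReal.ofReal w :=
    ⟨_, ENNReal.toReal_nonneg, (ENNReal.ofReal_toReal hfin).symm⟩
  have hcoe : ((wassersteinSq (μ : Measure (Torus n)) volume : ℝ≥0∞) : EReal) = (w : ℝ) := by
    rw [hw, EReal.coe_ennreal_ofReal, max_eq_left hw0]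
  rw [hcoe, ← EReal.coe_neg]
  refine EReal.ge_of_forall_gt_iff_ge.1 fun t ht => ?_
  have ht' : t < -w := by exact_mod_cast ht
  -- Half of the gap pays for a plan that is not optimal, the other half for the errors.
  obtain ⟨g, hwg, hgt⟩ : ∃ g : ℝ, w < g ∧ t < -g := ⟨(w - t) / 2, by linarith, by linarith⟩
  have hg : wassersteinSq (μ : Measure (Torus n)) volume < ENNReal.ofReal g := by
    rw [hw]
    exact (ENNReal.ofReal_lt_ofReal_iff_of_nonneg hw0).2 hwg
  obtain ⟨I, ε, hε, hev⟩ := exists_test_of_mem_nhds hμ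
  have hlim : Tendsto (fun δ : ℝ => n * δ) (𝓝[>] 0) (𝓝 0) := by
    have : Tendsto (fun δ : ℝ => n * δ) (𝓝 0) (𝓝 (n * 0)) := tendsto_id.const_mul _
    rw [mul_zero] at this
    exact this.mono_left nhdsWithin_le_nhds
  obtain ⟨δ, ⟨hδU, hδt⟩, hδ⟩ := ((hev.and (hlim.eventually_lt_const
    (show 0 < -g - t by linarith))).and self_mem_nhdsWithin).exists
  obtain ⟨a, ha, hball⟩ := exists_pos_le_measure_ball μ₀ (Set.mem_Ioi.1 hδ)
  refine le_liminf_of_le (h := ?_)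
  filter_upwards [(tendsto_const_mul_inv_pnat (Real.log (gaussConst n / a))).eventually_lt_const
    (show 0 < -g - t - n * δ by linarith),
    tendsto_coe_pnat_atTop.eventually (eventually_exists_configuration hg I hε)] with k hk hconf
  obtain ⟨y, hy, hyI⟩ := hconf inferInstance
  refine (EReal.coe_le_coe_iff.2
    (show t ≤ -g - n * δ - Real.log (gaussConst n / a) * ((k : ℕ) : ℝ)⁻¹ by linarith)).trans
    (le_log_div (rate_pos n k) ?_)
  rw [empiricalLaw_apply μ₀ k _ hE]
  exact le_normalizedProcess μ₀ k hE ha hball y hy (hδU _ y hyI)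

end Bounds

lemma isProbabilityMeasure_empiricalLaw {n : ℕ} (μ₀ : Measure (Torus n)) [IsProbabilityMeasure μ₀]
    [μ₀.IsOpenPosMeasure] (k : ℕ+) :
    IsProbabilityMeasure (empiricalLaw μ₀ k ((k : ℕ) : ℝ)) := by
  constructor
  rw [empiricalLaw_apply μ₀ k _ MeasurableSet.univ, Set.preimage_univ]
  exact ENNReal.inv_mul_cancel (unnormalizedProcess_univ_ne_zero μ₀ k)
    (unnormalizedProcess_univ_ne_top μ₀ k)

end TorusLDP

theorem mainTheorem6 (n : ℕ) (μ₀ : MeasureTheory.Measure (TorusLDP.Torus n))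
    (hprob : MeasureTheory.IsProbabilityMeasure μ₀)
    (hdensity : ∃ ρ : TorusLDP.Torus n → ℝ≥0∞, Measurable ρ ∧ (∀ x, 0 < ρ x) ∧
      μ₀ = MeasureTheory.volume.withDensity ρ) :
    TorusLDP.SatisfiesLDP
      (fun k : ℕ+ => TorusLDP.empiricalLaw μ₀ k ((k : ℕ) : ℝ))
      (fun μ : MeasureTheory.ProbabilityMeasure (TorusLDP.Torus n) =>
        ((TorusLDP.wassersteinSq (μ : MeasureTheory.Measure (TorusLDP.Torus n))
          MeasureTheory.volume : ℝ≥0∞) : EReal))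
      (fun k : ℕ+ => ((k : ℕ) : ℝ) * (((k : ℕ) ^ n : ℕ) : ℝ)) := by
  obtain ⟨ρ, hρ, hpos, hμ₀⟩ := hdensity
  have hopen : μ₀.IsOpenPosMeasure := by
    rw [hμ₀]
    exact (withDensity_absolutelyContinuous' hρ.aemeasurable
      (ae_of_all _ fun x => (hpos x).ne')).isOpenPosMeasure
  exact {
    isProbabilityMeasure := TorusLDP.isProbabilityMeasure_empiricalLaw μ₀
    lowerSemicontinuous := continuous_coe_ennreal_ereal.comp_lowerSemicontinuous
      (TorusLDP.lowerSemicontinuous_wassersteinSq n) fun _ _ h =>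
        EReal.coe_ennreal_le_coe_ennreal_iff.2 h
    tendsto_rate := TorusLDP.tendsto_rate n
    lower_bound := fun E hE => by
      rw [EReal.neg_le]
      exact le_iInf₂ fun μ hμ => EReal.neg_le.1 (TorusLDP.le_liminf_log_empiricalLaw μ₀ hE
        (mem_interior_iff_mem_nhds.1 hμ))
    upper_bound := fun E hE => (TorusLDP.limsup_log_empiricalLaw_le μ₀ hE).trans
      (EReal.neg_le_neg_iff.2 (biInf_mono fun μ hμ => subset_closure hμ)) }
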